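/- Let $(\varphi_j)_{j\ge 1}$ be the Fourier basis of $L^2([0,1])$: $\varphi_1\equiv 1$, $\varphi_{2m}(x)=\sqrt2\cos(2\pi mx)$, $\varphi_{2m+1}(x)=\sqrt2\sin(2\pi mx)$ for $m\ge1$. For $\alpha,L>0$ let $\mathcal W(\alpha,L)$ be the set of all $f=\sum_{j\ge1}\theta_j\varphi_j$ in $L^2([0,1])$ with $(\theta_j)\in\ell^2$ and $\sum_{j\ge1}a_j^2\theta_j^2\le L^2/\pi^{2\alpha}$, where $a_j=j^\alpha$ for $j$ even and $a_j=(j-1)^\alpha$ for $j$ odd. Let $\alpha>1/2$, $L>0$, $\sigma>0$, and let $f\in\mathcal W(\alpha,L)$, represented by its continuous version on $[0,1]$, with $\mathcal F(f):=\int_0^1f^2>0$. For $n\ge1$ one observes $Y=F_0+\varepsilon\in\mathbb R^n$, where $F_0=(f(i/n))_{1\le i\le n}$ and $\varepsilon\sim\mathcal N(0,\sigma^2I_n)$; $\mathbb E$ and $\mathbb P$ refer to this distribution of $Y$. Given integers $k_n$, put $\phi_j=(\varphi_j(i/n))_{1\le i\le n}$ for $1\le j\le k_n$, let $\langle\phi\rangle$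 be their linear span in $\mathbb R^n$, and let $Y_{\langle\phi\rangle}$ and $F_{\langle\phi\rangle}$ be the orthogonal projections of $Y$ and $F_0$ on $\langle\phi\rangle$. Let $G(F)=\|F\|^2/n$ for $F\in\mathbb R^n$. In the Bayesian model $Y\mid F\sim\mathcal N(F,\sigma^2I_n)$, let $W$ be the prior on $F=\sum_{j=1}^{k_n}\theta_j\phi_j$ induced by the prior $\mathcal N(0,\gamma_nI_{k_n})$ on $\theta$, where $\gamma_n>0$ and $1/\sqrt n=o(\gamma_n)$, and let $W(\cdot\mid Y)$ denote the posterior. Let $\mathcal I$ be the collection of all intervals of $\mathbb R$, and let $\psi(I)=\mathcal N(0,1)(I)$ for $I\in\mathcal I$. Then $(k_n)$ with $1\le k_n\le n$ can be chosen such that $k_n=o(\sqrt n)$ and $\sqrt n=o(k_n^{2\alpha})$; moreover the single choice $k_n=\lfloor\sqrt n/\ln n\rfloor$ ($n\ge2$) satisfies these two conditions for every $\alpha>1/2$ (adaptivity). For every sequence $(k_n)$ satisfying the two conditions, as $n\to\infty$: 1. $\displaystyle \mathbb E\Big[\sup_{I\in\mathcal I}\Big|W\Big(\frac{\sqrt n\,(G(F)-G(Y_{\langle\phi\rangle}))}{2\sigma\sqrt{\mathcal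 F(f)}}\in I\,\Big|\,Y\Big)-\psi(I)\Big|\Big]\to0$; 2. $\displaystyle \frac{\sqrt n\,(G(Y_{\langle\phi\rangle})-G(F_{\langle\phi\rangle}))}{2\sigma\sqrt{\mathcal F(f)}}\to\mathcal N(0,1)$ in distribution; 3. the bias is negligible with respect to the square root of the variance: $\displaystyle \frac{\sqrt n\,(G(F_{\langle\phi\rangle})-\mathcal F(f))}{2\sigma\sqrt{\mathcal F(f)}}=o(1)$. -/

import Mathlib

open MeasureTheory ProbabilityTheory Filter Asymptotics
open scoped Topology ENNReal

namespace FourierRegression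

noncomputable section

/-! ### The Fourier basis and the periodic Sobolev classes -/

/-- The Fourier basis of `L²([0,1])`, indexed by `j ≥ 1`: `φ₁ = 1`, `φ_{2m}(x) = √2 cos(2πmx)`,
`φ_{2m+1}(x) = √2 sin(2πmx)` for `m ≥ 1`.
Here `j / 2` is the integer quotient; the value at `j = 0` is never used. -/
def trigBasis (j : ℕ) (x : ℝ) : ℝ :=
  if j = 1 then 1
  else if Even j then √2 * Real.cos (2 * Real.pi * ((j / 2 : ℕ) : ℝ) * x)
  else √2 * Real.sin (2 * Real.pi * ((j / 2 : ℕ) : ℝ) * x)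

/-- The weights `a_j = j ^ α` for `j` even and `a_j = (j - 1) ^ α` for `j` odd (`j ≥ 1`). -/
def sobolevWeight (α : ℝ) (j : ℕ) : ℝ :=
  if Even j then (j : ℝ) ^ α else ((j : ℝ) - 1) ^ α

/-- The ellipsoid `Θ(α, L)` of `ℓ²`: sequences `(θ_j)_{j ≥ 1}` in `ℓ²` with
`∑_{j ≥ 1} a_j² θ_j² ≤ L² / π^{2α}`. The value `θ 0` is never used. -/
def sobolevEllipsoid (α L : ℝ) : Set (ℕ → ℝ) :=
  {θ | Summable (fun j : ℕ => θ (j + 1) ^ 2) ∧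
    Summable (fun j : ℕ => sobolevWeight α (j + 1) ^ 2 * θ (j + 1) ^ 2) ∧
    ∑' j : ℕ, sobolevWeight α (j + 1) ^ 2 * θ (j + 1) ^ 2 ≤ L ^ 2 / Real.pi ^ (2 * α)}

/-- The periodic Sobolev class `W(α, L)`: functions of `L²([0,1])` of the form
`f = ∑_{j ≥ 1} θ_j φ_j`, the series converging in `L²([0,1])`, with `θ ∈ Θ(α, L)`. -/
def sobolevClass (α L : ℝ) : Set (ℝ → ℝ) :=
  {f | MemLp f 2 (volume.restrict (Set.Icc (0 : ℝ) 1)) ∧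
    ∃ θ ∈ sobolevEllipsoid α L,
      Tendsto
        (fun N : ℕ => eLpNorm (fun x => f x - ∑ j ∈ Finset.Icc 1 N, θ j * trigBasis j x) 2
          (volume.restrict (Set.Icc (0 : ℝ) 1)))
        atTop (𝓝 0)}

/-! ### The regression model -/

/-- The vector `(g(i/n))_{1 ≤ i ≤ n}` of the values of `g` on the regular design. -/
def designValues (n : ℕ) (g : ℝ → ℝ) : EuclideanSpace ℝ (Fin n) :=
  WithLp.toLp 2 (fun i : Fin n => g (((i : ℕ) + 1 : ℝ) / (n : ℝ)))

/-- The linear map `θ ↦ Φ θ = ∑_{j = 1}^k θ_j φ_j`, with the regressors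
`φ_j = (φ_j(i/n))_{1 ≤ i ≤ n}`. -/
def designMap (n k : ℕ) (θ : EuclideanSpace ℝ (Fin k)) : EuclideanSpace ℝ (Fin n) :=
  ∑ j : Fin k, θ j • designValues n (trigBasis ((j : ℕ) + 1))

/-- The linear span of the first `k` regressors in `ℝⁿ`. -/
def sieve (n k : ℕ) : Submodule ℝ (EuclideanSpace ℝ (Fin n)) :=
  Submodule.span ℝ
    (Set.range fun j : Fin k => designValues n (trigBasis ((j : ℕ) + 1)))

/-- The orthogonal projection of `ℝⁿ` onto the span of the first `k` regressors. Applied to the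
observation `Y` it gives the MLE of the mean vector within the span. -/
def proj (n k : ℕ) (y : EuclideanSpace ℝ (Fin n)) : EuclideanSpace ℝ (Fin n) :=
  (sieve n k).starProjection y

/-- The sampling distribution `N(F, σ² I_n)` of the observation `Y` when the mean vector is `F`. -/
def sampling (n : ℕ) (σ : ℝ) (F : EuclideanSpace ℝ (Fin n)) :
    Measure (EuclideanSpace ℝ (Fin n)) :=
  multivariateGaussian F (σ ^ 2 • (1 : Matrix (Fin n) (Fin n) ℝ))

instance (n : ℕ) (σ : ℝ) (F : EuclideanSpace ℝ (Fin n)) :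
    IsProbabilityMeasure (sampling n σ F) := by
  unfold sampling; infer_instance

theorem measurable_sampling (n : ℕ) (σ : ℝ) : Measurable (sampling n σ) := by
  have h : sampling n σ = fun F =>
      ((Kernel.id ×ₖ Kernel.const (EuclideanSpace ℝ (Fin n))
        (sampling n σ 0)).map (fun p => p.1 + p.2)) F := by
    funext F
    have hm : Measurable
        (fun p : EuclideanSpace ℝ (Fin n) × EuclideanSpace ℝ (Fin n) => p.1 + p.2) := by
      fun_prop
    rw [Kernel.map_apply _ hm, Kernel.prod_apply, Kernel.id_apply, Kernel.const_apply,
      Measure.dirac_prod, Measure.map_map hm (by fun_prop), sampling, sampling,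
      multivariateGaussian, multivariateGaussian, Measure.map_map (by fun_prop) (by fun_prop)]
    congr 1
    funext x
    simp
  rw [h]
  exact Kernel.measurable _

/-- The statistical model `F ↦ N(F, σ² I_n)` as a Markov kernel. -/
def model (n : ℕ) (σ : ℝ) : Kernel (EuclideanSpace ℝ (Fin n)) (EuclideanSpace ℝ (Fin n)) where
  toFun := sampling n σ
  measurable' := measurable_sampling n σ

instance (n : ℕ) (σ : ℝ) : IsMarkovKernel (model n σ) :=
  ⟨fun F => inferInstanceAs (IsProbabilityMeasure (sampling n σ F))⟩

/-- The prior `W` on `F = Φ θ ∈ ℝⁿ` induced by the prior `N(0, γ I_k)` on `θ ∈ ℝᵏ`. -/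
def prior (n k : ℕ) (γ : ℝ) : Measure (EuclideanSpace ℝ (Fin n)) :=
  (multivariateGaussian (0 : EuclideanSpace ℝ (Fin k))
    (γ • (1 : Matrix (Fin k) (Fin k) ℝ))).map (designMap n k)

theorem measurable_designMap (n k : ℕ) : Measurable (designMap n k) := by
  unfold designMap; fun_prop

instance (n k : ℕ) (γ : ℝ) : IsProbabilityMeasure (prior n k γ) :=
  Measure.isProbabilityMeasure_map (measurable_designMap n k).aemeasurable

/-- The posterior distribution `W(dF | Y = y)` of the mean vector `F` given the observation `y`. -/
def posteriorDist (n k : ℕ) (σ γ : ℝ) (y : EuclideanSpace ℝ (Fin n)) :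
    Measure (EuclideanSpace ℝ (Fin n)) :=
  posterior (model n σ) (prior n k γ) y

/-- The functional `G(F) = ‖F‖² / n`. -/
def sqNormFunctional (n : ℕ) (F : EuclideanSpace ℝ (Fin n)) : ℝ :=
  ‖F‖ ^ 2 / n

/-- `sup_I |P(I) - Q(I)|` over all intervals `I` of `ℝ`. -/
def intervalDist (P Q : Measure ℝ) : ℝ≥0∞ :=
  ⨆ (I : Set ℝ) (_ : I.OrdConnected), ENNReal.ofReal |P.real I - Q.real I|

/-- The conditions on the dimension of the sieve: `k_n = o(√n)` and `√n = o(k_n^{2α})`. -/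
def AdmissibleCutoff (α : ℝ) (k : ℕ → ℕ) : Prop :=
  (fun n : ℕ => (k n : ℝ)) =o[atTop] (fun n : ℕ => √(n : ℝ)) ∧
    (fun n : ℕ => √(n : ℝ)) =o[atTop] (fun n : ℕ => (k n : ℝ) ^ (2 * α))

end

end FourierRegression

open FourierRegression

namespace FourierRegression

open scoped RealInnerProductSpace

/-! ### Absolute continuity of Gaussian measures -/

/-! For `k < n` the regressors are exactly orthogonal on the regular design, with squared norm `n`.
The prior on `F` is therefore the Gaussian with covariance `γ n P`, where `P` is the projection on
the sieve, and conjugacy gives the posterior as the law of `c v + σ √c P ξ`, with `v = P Y`, `c = γ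
n / (γ n + σ²)` and `ξ` standard Gaussian (`posteriorDist_eq`).

Write `T = ∫ f²` and `v = ‖v‖ u` with `‖u‖ = 1`. Expanding the square splits the rescaled deviation
of `G` into a shrinkage bias of order `(1 - c²) √n`, a linear term `c √c √(G(v)/T) ⟪u, ξ⟫`, and a
quadratic term of mean at most a constant times `k / √n`. Since `⟪u, ξ⟫` is exactly `N(0,1)`, the
deviation and its Gaussian limit live on one probability space, and their `L¹` distance is at most
`couplingBound` (`integral_abs_scaledDeviation_sub_le`). This bound vanishes because `1/√n = o(γ)`,
`k = o(√n)` and `G(P Y)/T → 1` in mean. A coupling close in `L¹` controls the interval distance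
(`intervalDist_le_of_coupling`) and gives convergence in distribution
(`tendstoInDistribution_of_coupling`). The plug-in estimator is the same expansion with `c = 1` and
`v = P F₀`.

For the bias, `α > 1/2` makes the Fourier series of `f` absolutely convergent. The part of index
below `n` projects without aliasing and contributes exactly the sum of the first `k` squared
coefficients. The part of index at least `n` is cut into blocks of length `n`, on each of which
complex exponentials stay orthogonal on the design; its normalized norm is `O(n^(-α))`. Hence the
bias is `O(n^(-α) + k^(-2α))` (`exists_bias_bound`), which is `o(1/√n)`. -/

theorem pi_absolutelyContinuous :
    ∀ {n : ℕ} {μ ν : Fin n → Measure ℝ} [∀ i, SigmaFinite (μ i)] [∀ i, SigmaFinite (ν i)],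
      (∀ i, μ i ≪ ν i) → Measure.pi μ ≪ Measure.pi ν
  | 0, μ, ν, _, _, _ => by
    rw [Measure.pi_of_empty, Measure.pi_of_empty]
  | n + 1, μ, ν, _, _, h => by
    have h1 := (measurePreserving_piFinSuccAbove μ 0).symm.map_eq
    have h2 := (measurePreserving_piFinSuccAbove ν 0).symm.map_eq
    rw [← h1, ← h2]
    refine Measure.AbsolutelyContinuous.map ?_ (MeasurableEquiv.measurable _)
    exact (h 0).prod (pi_absolutelyContinuous fun i => h _)

theorem stdGaussian_absolutelyContinuous (n : ℕ) :
    stdGaussian (EuclideanSpace ℝ (Fin n)) ≪ volume ∧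
      volume ≪ stdGaussian (EuclideanSpace ℝ (Fin n)) := by
  rw [← map_pi_eq_stdGaussian, ← (PiLp.volume_preserving_toLp (Fin n)).map_eq, volume_pi]
  constructor
  · refine Measure.AbsolutelyContinuous.map (pi_absolutelyContinuous fun i => ?_) (by fun_prop)
    exact gaussianReal_absolutelyContinuous 0 one_ne_zero
  · refine Measure.AbsolutelyContinuous.map (pi_absolutelyContinuous fun i => ?_) (by fun_prop)
    exact gaussianReal_absolutelyContinuous' 0 one_ne_zero

theorem posSemidef_smul_one (n : ℕ) {a : ℝ} (ha : 0 ≤ a) :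
    (a • (1 : Matrix (Fin n) (Fin n) ℝ)).PosSemidef :=
  Matrix.PosSemidef.one.smul ha

/-- The image law depends on `A` only through the quadratic form `t ↦ ‖A* t‖²`. Laws coming from
standard Gaussians on different spaces are thus identified by comparing these forms. -/
theorem charFun_map_stdGaussian {E F : Type*}
    [NormedAddCommGroup E] [InnerProductSpace ℝ E] [FiniteDimensional ℝ E] [MeasurableSpace E]
    [BorelSpace E] [NormedAddCommGroup F] [InnerProductSpace ℝ F] [FiniteDimensional ℝ F]
    [MeasurableSpace F] [BorelSpace F] (A : E →L[ℝ] F) (t : F) :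
    charFun ((stdGaussian E).map A) t
      = Complex.exp (-((‖ContinuousLinearMap.adjoint A t‖ ^ 2 / 2 : ℝ) : ℂ)) := by
  have : charFun ((stdGaussian E).map A) t
      = charFun (stdGaussian E) (ContinuousLinearMap.adjoint A t) := by
    rw [charFun_apply, charFun_apply, integral_map (by fun_prop) (by fun_prop)]
    simp_rw [ContinuousLinearMap.adjoint_inner_right]
  rw [this, charFun_stdGaussian]
  congr 1
  push_cast
  ring

theorem dotProduct_smul_one (n : ℕ) (a : ℝ) (t : EuclideanSpace ℝ (Fin n)) :
    dotProduct t.ofLp (Matrix.mulVec (a • (1 : Matrix (Fin n) (Fin n) ℝ)) t.ofLp)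
      = a * ‖t‖ ^ 2 := by
  rw [Matrix.smul_mulVec, Matrix.one_mulVec, dotProduct_smul, smul_eq_mul,
    EuclideanSpace.real_norm_sq_eq]
  simp [dotProduct, sq]

theorem multivariateGaussian_smul_one (n : ℕ) {a : ℝ} (ha : 0 ≤ a)
    (F : EuclideanSpace ℝ (Fin n)) :
    multivariateGaussian F (a ^ 2 • (1 : Matrix (Fin n) (Fin n) ℝ))
      = (stdGaussian (EuclideanSpace ℝ (Fin n))).map (fun x => F + a • x) := by
  have hm : (fun x : EuclideanSpace ℝ (Fin n) => F + a • x)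
      = (fun x => F + x) ∘ (fun x => a • x) := rfl
  rw [hm, ← Measure.map_map (by fun_prop) (by fun_prop)]
  apply Measure.ext_of_charFun
  ext t
  rw [charFun_map_const_add, charFun_map_smul, charFun_stdGaussian,
    charFun_multivariateGaussian (posSemidef_smul_one n (sq_nonneg a)), dotProduct_smul_one,
    ← Complex.exp_add, norm_smul, real_inner_comm, Real.norm_of_nonneg ha]
  congr 1
  push_cast
  ring

theorem sampling_eq (n : ℕ) {σ : ℝ} (hσ : 0 ≤ σ) (F : EuclideanSpace ℝ (Fin n)) :
    sampling n σ F = (stdGaussian (EuclideanSpace ℝ (Fin n))).map (fun x => F + σ • x) :=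
  multivariateGaussian_smul_one n hσ F

theorem volume_map_affine (n : ℕ) {σ : ℝ} (hσ : 0 < σ) (F : EuclideanSpace ℝ (Fin n)) :
    ∃ c : ℝ≥0∞, c ≠ 0 ∧
      (volume : Measure (EuclideanSpace ℝ (Fin n))).map (fun x => F + σ • x) = c • volume := by
  have hm : (fun x : EuclideanSpace ℝ (Fin n) => F + σ • x)
      = (fun x => F + x) ∘ (fun x => σ • x) := rfl
  rw [hm, ← Measure.map_map (by fun_prop) (by fun_prop), Measure.map_addHaar_smul _ hσ.ne',
    Measure.map_smul, (measurePreserving_add_left volume F).map_eq]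
  refine ⟨_, ?_, rfl⟩
  simp only [ne_eq, ENNReal.ofReal_eq_zero, not_le]
  positivity

theorem sampling_absolutelyContinuous (n : ℕ) {σ : ℝ} (hσ : 0 < σ)
    (F F' : EuclideanSpace ℝ (Fin n)) : sampling n σ F ≪ sampling n σ F' := by
  obtain ⟨c, hc, h⟩ := volume_map_affine n hσ F
  obtain ⟨c', hc', h'⟩ := volume_map_affine n hσ F'
  rw [sampling_eq n hσ.le, sampling_eq n hσ.le]
  have h1 := (stdGaussian_absolutelyContinuous n).1.map
    (f := fun x => F + σ • x) (by fun_prop)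
  have h2 := (stdGaussian_absolutelyContinuous n).2.map
    (f := fun x => F' + σ • x) (by fun_prop)
  rw [h] at h1
  rw [h'] at h2
  refine h1.trans (Measure.smul_absolutelyContinuous.trans ?_)
  exact (Measure.absolutelyContinuous_smul hc').trans h2

/-- A posterior is determined only almost surely for the marginal law of `Y`; this transfers such
statements to the true law. A set null for the marginal is null for `sampling n σ F'` for some `F'`,
hence for every mean, the Gaussians being mutually absolutely continuous. -/
theorem sampling_absolutelyContinuous_comp (n : ℕ) {σ : ℝ} (hσ : 0 < σ)
    (F : EuclideanSpace ℝ (Fin n)) (μ : Measure (EuclideanSpace ℝ (Fin n)))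
    [IsProbabilityMeasure μ] : sampling n σ F ≪ model n σ ∘ₘ μ := by
  intro s hs
  have h := Measure.ae_ae_of_ae_comp (p := fun x => x ∉ s)
    (compl_mem_ae_iff.mpr hs : ∀ᵐ x ∂(model n σ ∘ₘ μ), x ∉ s)
  obtain ⟨F', hF'⟩ := h.exists
  have : sampling n σ F' s = 0 := by
    have h1 : ∀ᵐ x ∂(sampling n σ F'), x ∉ s := hF'
    exact compl_mem_ae_iff.mp h1
  exact sampling_absolutelyContinuous n hσ F F' this

/-! ### Kernels given by a measurable map and an independent noise -/

section NoiseKernel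

variable {X Y Z : Type*} [MeasurableSpace X] [MeasurableSpace Y] [MeasurableSpace Z]

theorem compProd_eq_map_prod {μ : Measure X} {ν : Measure Z} [SFinite μ] [SFinite ν]
    {h : X × Z → Y} (hh : Measurable h) (κ : Kernel X Y) [IsSFiniteKernel κ]
    (hκ : ∀ x, κ x = ν.map (fun z => h (x, z))) :
    μ ⊗ₘ κ = (μ.prod ν).map (fun p => (p.1, h p)) := by
  ext s hs
  rw [Measure.compProd_apply hs, Measure.map_apply (by fun_prop) hs,
    Measure.prod_apply (measurableSet_preimage (by fun_prop) hs)]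
  refine lintegral_congr fun x => ?_
  rw [hκ, Measure.map_apply (by fun_prop) (measurable_prodMk_left hs)]
  rfl

theorem comp_eq_map_prod {μ : Measure X} {ν : Measure Z} [SFinite μ] [SFinite ν]
    {h : X × Z → Y} (hh : Measurable h) (κ : Kernel X Y) [IsSFiniteKernel κ]
    (hκ : ∀ x, κ x = ν.map (fun z => h (x, z))) :
    κ ∘ₘ μ = (μ.prod ν).map h := by
  rw [← Measure.snd_compProd, compProd_eq_map_prod hh κ hκ, Measure.snd,
    Measure.map_map measurable_snd (by fun_prop)]
  rfl

/-- The kernel sending `x` to the law of `h (x, z)` for `z` distributed according to `ν`. -/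
noncomputable def noiseKernel (ν : Measure Z) [IsProbabilityMeasure ν] (h : X × Z → Y) :
    Kernel X Y :=
  (Kernel.id ×ₖ Kernel.const X ν).map h

theorem noiseKernel_apply (ν : Measure Z) [IsProbabilityMeasure ν] {h : X × Z → Y}
    (hh : Measurable h) (x : X) : noiseKernel ν h x = ν.map (fun z => h (x, z)) := by
  rw [noiseKernel, Kernel.map_apply _ hh, Kernel.prod_apply, Kernel.id_apply, Kernel.const_apply,
    Measure.dirac_prod, Measure.map_map hh (by fun_prop)]
  rfl

end NoiseKernel

/-! ### The prior and the posterior under an orthogonal design -/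

/-- The regressors `φ_1, …, φ_k` are orthogonal with squared norm `n`. -/
def OrthogonalDesign (n k : ℕ) : Prop :=
  ∀ i j : Fin k, ⟪designValues n (trigBasis ((i : ℕ) + 1)),
    designValues n (trigBasis ((j : ℕ) + 1))⟫ = if i = j then (n : ℝ) else 0

theorem proj_eq_sum {n k : ℕ} (hn : n ≠ 0) (h : OrthogonalDesign n k)
    (t : EuclideanSpace ℝ (Fin n)) :
    proj n k t = ∑ j : Fin k, ((n : ℝ)⁻¹ * ⟪designValues n (trigBasis ((j : ℕ) + 1)), t⟫) •
      designValues n (trigBasis ((j : ℕ) + 1)) := by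
  have hn' : (n : ℝ) ≠ 0 := by exact_mod_cast hn
  rw [proj]
  refine Submodule.eq_starProjection_of_mem_of_inner_eq_zero ?_ ?_
  · exact Submodule.sum_mem _ fun j _ => Submodule.smul_mem _ _ (Submodule.subset_span ⟨j, rfl⟩)
  · intro w hw
    induction hw using Submodule.span_induction with
    | mem x hx =>
      obtain ⟨i, rfl⟩ := hx
      unfold OrthogonalDesign at h
      beta_reduce
      rw [inner_sub_left, sum_inner]
      simp_rw [inner_smul_left, h]
      simp [hn', real_inner_comm, mul_comm]
    | zero => simp
    | add x y _ _ hx hy => rw [inner_add_right, hx, hy, add_zero]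
    | smul a x _ hx => rw [inner_smul_right, hx, mul_zero]

theorem norm_proj_sq {n k : ℕ} (t : EuclideanSpace ℝ (Fin n)) :
    ‖proj n k t‖ ^ 2 = ⟪proj n k t, t⟫ := by
  rw [proj, ← real_inner_self_eq_norm_sq, Submodule.inner_starProjection_left_eq_right,
    Submodule.starProjection_eq_self_iff.2 (Submodule.starProjection_apply_mem _ _),
    Submodule.inner_starProjection_left_eq_right]

theorem norm_proj_sq_eq_sum {n k : ℕ} (hn : n ≠ 0) (h : OrthogonalDesign n k)
    (t : EuclideanSpace ℝ (Fin n)) :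
    n * ‖proj n k t‖ ^ 2 = ∑ j : Fin k, ⟪designValues n (trigBasis ((j : ℕ) + 1)), t⟫ ^ 2 := by
  have hn' : (n : ℝ) ≠ 0 := by exact_mod_cast hn
  rw [norm_proj_sq, proj_eq_sum hn h, sum_inner, Finset.mul_sum]
  refine Finset.sum_congr rfl fun j _ => ?_
  rw [inner_smul_left]
  simp only [conj_trivial]
  field_simp

/-- The linear map `designMap` as a continuous linear map. -/
noncomputable def designCLM (n k : ℕ) :
    EuclideanSpace ℝ (Fin k) →L[ℝ] EuclideanSpace ℝ (Fin n) :=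
  ∑ j : Fin k, (EuclideanSpace.proj j : EuclideanSpace ℝ (Fin k) →L[ℝ] ℝ).smulRight
    (designValues n (trigBasis ((j : ℕ) + 1)))

theorem designCLM_apply (n k : ℕ) (θ : EuclideanSpace ℝ (Fin k)) :
    designCLM n k θ = designMap n k θ := by
  simp [designCLM, designMap]

theorem norm_adjoint_designCLM_sq {n k : ℕ} (t : EuclideanSpace ℝ (Fin n)) :
    ‖ContinuousLinearMap.adjoint (designCLM n k) t‖ ^ 2
      = ∑ j : Fin k, ⟪designValues n (trigBasis ((j : ℕ) + 1)), t⟫ ^ 2 := by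
  rw [EuclideanSpace.real_norm_sq_eq]
  refine Finset.sum_congr rfl fun j _ => ?_
  have h1 : (ContinuousLinearMap.adjoint (designCLM n k) t) j
      = ⟪EuclideanSpace.single j (1 : ℝ), ContinuousLinearMap.adjoint (designCLM n k) t⟫ := by
    simp [EuclideanSpace.inner_single_left]
  rw [h1, ContinuousLinearMap.adjoint_inner_right, designCLM_apply, designMap]
  simp

/-- Orthogonality gives `γ ∑ ⟪φ_j, t⟫² = γ n ‖P t‖²`, so the two covariance forms agree. From here
on the coordinates `θ` disappear and only the projection matters. -/
theorem prior_eq {n k : ℕ} (hn : n ≠ 0) (h : OrthogonalDesign n k) {γ : ℝ} (hγ : 0 ≤ γ) :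
    prior n k γ = (stdGaussian (EuclideanSpace ℝ (Fin n))).map
      (√(γ * n) • (sieve n k).starProjection) := by
  have h1 : prior n k γ = (stdGaussian (EuclideanSpace ℝ (Fin k))).map
      (√γ • designCLM n k : EuclideanSpace ℝ (Fin k) →L[ℝ] EuclideanSpace ℝ (Fin n)) := by
    have h2 := multivariateGaussian_smul_one k (Real.sqrt_nonneg γ) 0
    rw [Real.sq_sqrt hγ] at h2
    rw [prior, h2, Measure.map_map (measurable_designMap n k) (by fun_prop)]
    congr 1
    ext1 x
    simp [← designCLM_apply]
  rw [h1]
  apply Measure.ext_of_charFun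
  ext t
  rw [charFun_map_stdGaussian, charFun_map_stdGaussian]
  have hs := (isSelfAdjoint_starProjection (sieve n k))
  simp only [map_smulₛₗ, smul_apply, norm_smul, mul_pow,
    norm_adjoint_designCLM_sq]
  rw [← ContinuousLinearMap.star_eq_adjoint, hs.star_eq]
  simp only [conj_trivial, Real.norm_eq_abs, sq_abs]
  rw [Real.sq_sqrt hγ, Real.sq_sqrt (by positivity), ← norm_proj_sq_eq_sum hn h, ← mul_assoc, proj]

theorem charFunDual_eq_charFun_of_inner {E : Type*} [NormedAddCommGroup E] [InnerProductSpace ℝ E]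
    [MeasurableSpace E] {ν : Measure E} {L : StrongDual ℝ E} {w : E} (h : ∀ v, L v = ⟪v, w⟫) :
    charFunDual ν L = charFun ν w := by
  simp_rw [charFunDual_apply, charFun_apply, h]

section Posterior

variable {n : ℕ}

local notation "𝔼" => EuclideanSpace ℝ (Fin n)

theorem charFun_map_smul_starProjection (U : Submodule ℝ 𝔼) {a : ℝ} (ha : 0 ≤ a) (t : 𝔼) :
    charFun ((stdGaussian 𝔼).map (√a • U.starProjection)) t
      = Complex.exp (-((a * ‖U.starProjection t‖ ^ 2 / 2 : ℝ) : ℂ)) := by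
  rw [charFun_map_stdGaussian, map_smulₛₗ, ← ContinuousLinearMap.star_eq_adjoint,
    (isSelfAdjoint_starProjection U).star_eq]
  simp only [conj_trivial, smul_apply, norm_smul, mul_pow, Real.norm_eq_abs, sq_abs]
  rw [Real.sq_sqrt ha]

theorem charFun_model_comp (U : Submodule ℝ 𝔼) {a σ : ℝ} (ha : 0 ≤ a) (hσ : 0 ≤ σ) (t : 𝔼) :
    charFun (model n σ ∘ₘ (stdGaussian 𝔼).map (√a • U.starProjection)) t
      = Complex.exp (-(((a * ‖U.starProjection t‖ ^ 2 + σ ^ 2 * ‖t‖ ^ 2) / 2 : ℝ) : ℂ)) := by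
  have hm : Measurable (fun p : 𝔼 × 𝔼 => p.1 + σ • p.2) := by fun_prop
  have : IsProbabilityMeasure ((stdGaussian 𝔼).map (√a • U.starProjection)) :=
    Measure.isProbabilityMeasure_map (by fun_prop)
  rw [comp_eq_map_prod (ν := stdGaussian 𝔼) hm _ (fun x => sampling_eq n hσ x)]
  have hB : (fun p : 𝔼 × 𝔼 => p.1 + σ • p.2) =
    (ContinuousLinearMap.fst ℝ 𝔼 𝔼 + σ • ContinuousLinearMap.snd ℝ 𝔼 𝔼 : 𝔼 × 𝔼 →L[ℝ] 𝔼) := rfl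
  rw [hB, ← charFunDual_eq_charFun_of_inner (L := innerSL ℝ t)
    (fun v => by simp [real_inner_comm]), charFunDual_map, charFunDual_prod,
    charFunDual_eq_charFun_of_inner (w := t), charFunDual_eq_charFun_of_inner (w := σ • t),
    charFun_map_smul_starProjection U ha, charFun_stdGaussian, ← Complex.exp_add]
  · rw [norm_smul, Real.norm_of_nonneg hσ]
    congr 1
    push_cast
    ring
  · intro v
    simp [inner_smul_right, real_inner_comm]
  · intro v
    simp [real_inner_comm]

/-- The conjugate posterior: shrinkage of the projected observation by the factor `c`, with
Gaussian fluctuations of variance `σ² c` inside the subspace. -/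
noncomputable def gaussianPosterior (U : Submodule ℝ 𝔼) (σ c : ℝ) : Kernel 𝔼 𝔼 :=
  noiseKernel (stdGaussian 𝔼)
    (fun p : 𝔼 × 𝔼 => c • U.starProjection p.1 + (σ * √c) • U.starProjection p.2)

theorem measurable_posteriorMap (U : Submodule ℝ 𝔼) (σ c : ℝ) :
    Measurable (fun p : 𝔼 × 𝔼 => c • U.starProjection p.1 + (σ * √c) • U.starProjection p.2) := by
  fun_prop

instance (U : Submodule ℝ 𝔼) (σ c : ℝ) : IsMarkovKernel (gaussianPosterior U σ c) := by
  unfold gaussianPosterior noiseKernel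
  exact Kernel.IsMarkovKernel.map _ (measurable_posteriorMap U σ c)

theorem gaussianPosterior_apply (U : Submodule ℝ 𝔼) (σ c : ℝ) (y : 𝔼) :
    gaussianPosterior U σ c y = (stdGaussian 𝔼).map
      (fun ξ => c • U.starProjection y + (σ * √c) • U.starProjection ξ) :=
  noiseKernel_apply _ (measurable_posteriorMap U σ c) y

/-- Bayes' formula as an equality of two joint laws of `(Y, F)`. Both are centered Gaussian, so it
reduces to an identity between quadratic forms, which is where `c (a + σ²) = a` enters. -/
theorem gaussianPosterior_compProd (U : Submodule ℝ 𝔼) {a σ c : ℝ} (ha : 0 ≤ a) (hσ : 0 < σ)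
    (hc : c = a / (a + σ ^ 2)) :
    (model n σ ∘ₘ (stdGaussian 𝔼).map (√a • U.starProjection)) ⊗ₘ gaussianPosterior U σ c
      = (((stdGaussian 𝔼).map (√a • U.starProjection)) ⊗ₘ model n σ).map Prod.swap := by
  have : IsProbabilityMeasure ((stdGaussian 𝔼).map (√a • U.starProjection)) :=
    Measure.isProbabilityMeasure_map (by fun_prop)
  have hm : Measurable (fun p : 𝔼 × 𝔼 => p.1 + σ • p.2) := by fun_prop
  have hc0 : 0 ≤ c := by rw [hc]; positivity
  rw [compProd_eq_map_prod (ν := stdGaussian 𝔼) (measurable_posteriorMap U σ c) _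
      (gaussianPosterior_apply U σ c),
    compProd_eq_map_prod (ν := stdGaussian 𝔼) hm (model n σ) (fun x => sampling_eq n hσ.le x),
    Measure.map_map measurable_swap (by fun_prop)]
  have hB1 : (fun p : 𝔼 × 𝔼 => (p.1, c • U.starProjection p.1 + (σ * √c) • U.starProjection p.2)) =
    ((ContinuousLinearMap.fst ℝ 𝔼 𝔼).prod
      (c • U.starProjection.comp (ContinuousLinearMap.fst ℝ 𝔼 𝔼)
        + (σ * √c) • U.starProjection.comp (ContinuousLinearMap.snd ℝ 𝔼 𝔼)) :
      𝔼 × 𝔼 →L[ℝ] 𝔼 × 𝔼) := rfl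
  have hB2 : (Prod.swap ∘ fun p : 𝔼 × 𝔼 => (p.1, p.1 + σ • p.2)) =
    ((ContinuousLinearMap.fst ℝ 𝔼 𝔼 + σ • ContinuousLinearMap.snd ℝ 𝔼 𝔼).prod
      (ContinuousLinearMap.fst ℝ 𝔼 𝔼) : 𝔼 × 𝔼 →L[ℝ] 𝔼 × 𝔼) := rfl
  rw [hB1, hB2]
  -- The product space carries the sup norm and no inner product, so characteristic functions are
  -- indexed by functionals; each one splits as `⟪·, s⟫ + ⟪·, t⟫`.
  apply Measure.ext_of_charFunDual
  ext L
  obtain ⟨s, hs⟩ : ∃ s : 𝔼, ∀ v, L (v, 0) = ⟪v, s⟫ :=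
    ⟨(InnerProductSpace.toDual ℝ 𝔼).symm (L.comp (.inl ℝ 𝔼 𝔼)), fun v => by
      rw [real_inner_comm, InnerProductSpace.toDual_symm_apply]; rfl⟩
  obtain ⟨t, ht⟩ : ∃ t : 𝔼, ∀ v, L (0, v) = ⟪v, t⟫ :=
    ⟨(InnerProductSpace.toDual ℝ 𝔼).symm (L.comp (.inr ℝ 𝔼 𝔼)), fun v => by
      rw [real_inner_comm, InnerProductSpace.toDual_symm_apply]; rfl⟩
  have hL : ∀ v w, L (v, w) = ⟪v, s⟫ + ⟪w, t⟫ := fun v w => by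
    rw [← hs, ← ht, ← map_add]; simp
  rw [charFunDual_map, charFunDual_map, charFunDual_prod, charFunDual_prod,
    charFunDual_eq_charFun_of_inner (w := s + c • U.starProjection t),
    charFunDual_eq_charFun_of_inner (w := (σ * √c) • U.starProjection t),
    charFunDual_eq_charFun_of_inner (w := s + t),
    charFunDual_eq_charFun_of_inner (w := σ • s),
    charFun_model_comp U ha hσ.le, charFun_map_smul_starProjection U ha, charFun_stdGaussian,
    charFun_stdGaussian, ← Complex.exp_add, ← Complex.exp_add]
  · congr 1
    have hPP : U.starProjection (U.starProjection t) = U.starProjection t :=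
      Submodule.starProjection_eq_self_iff.2 (Submodule.starProjection_apply_mem _ _)
    -- With this rewriting every term of `key` is expressed through `‖s‖`, `‖P s‖`, `‖P t‖` and `⟪P
    -- s, P t⟫`.
    have hst : ⟪s, U.starProjection t⟫ = ⟪U.starProjection s, U.starProjection t⟫ := by
      rw [← hPP, Submodule.inner_starProjection_left_eq_right, hPP, hPP]
    have hne : a + σ ^ 2 ≠ 0 := by positivity
    have key : (a * ‖U.starProjection (s + c • U.starProjection t)‖ ^ 2
        + σ ^ 2 * ‖s + c • U.starProjection t‖ ^ 2) + ‖(σ * √c) • U.starProjection t‖ ^ 2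
        = a * ‖U.starProjection (s + t)‖ ^ 2 + ‖σ • s‖ ^ 2 := by
      rw [map_add, map_add, map_smul, hPP, norm_add_sq_real, norm_add_sq_real, norm_add_sq_real,
        norm_smul, norm_smul, norm_smul, inner_smul_right, inner_smul_right, hst, mul_pow, mul_pow,
        mul_pow, Real.norm_eq_abs, Real.norm_eq_abs, Real.norm_eq_abs, sq_abs, sq_abs, sq_abs,
        mul_pow, Real.sq_sqrt hc0, hc]
      field_simp
      ring
    have key' := congrArg (fun r : ℝ => -((r : ℂ)) / 2) key
    push_cast at key' ⊢
    linear_combination key'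
  · intro v
    simp [hL, inner_smul_right, inner_smul_left]
  · intro v
    simp [hL, inner_add_right]
  · intro v
    simp [hL, inner_smul_right, Submodule.inner_starProjection_left_eq_right, inner_smul_left]
  · intro v
    simp [hL, inner_smul_right, inner_add_right, Submodule.inner_starProjection_left_eq_right,
      inner_smul_left]

theorem posteriorDist_eq {k : ℕ} (hn : n ≠ 0) (h : OrthogonalDesign n k) {σ γ : ℝ} (hσ : 0 < σ)
    (hγ : 0 < γ) (F : 𝔼) :
    ∀ᵐ y ∂(sampling n σ F), posteriorDist n k σ γ y
      = (stdGaussian 𝔼).map (fun ξ => (γ * n / (γ * n + σ ^ 2)) • proj n k y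
          + (σ * √(γ * n / (γ * n + σ ^ 2))) • proj n k ξ) := by
  have ha : 0 ≤ γ * n := by positivity
  have h1 := ae_eq_posterior_of_compProd_eq
    (κ := model n σ) (μ := prior n k γ)
    (η := gaussianPosterior (sieve n k) σ (γ * n / (γ * n + σ ^ 2))) (by
      rw [prior_eq hn h hγ.le]
      exact gaussianPosterior_compProd _ ha hσ rfl)
  filter_upwards [(sampling_absolutelyContinuous_comp n hσ F (prior n k γ)).ae_le h1] with y hy
  rw [posteriorDist, ← hy, gaussianPosterior_apply]
  rfl

end Posterior

/-! ### Gaussian linear and quadratic forms -/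

/-- Any unit vector serves when `v = 0`, so the coupling variable `⟪u, ξ⟫` is standard Gaussian
without excluding that case. -/
theorem exists_unit_vector_smul {E : Type*} [NormedAddCommGroup E] [InnerProductSpace ℝ E]
    [Nontrivial E] (v : E) : ∃ u : E, ‖u‖ = 1 ∧ v = ‖v‖ • u := by
  by_cases hv : v = 0
  · obtain ⟨u, hu⟩ := exists_norm_eq E zero_le_one
    exact ⟨u, hu, by simp [hv]⟩
  · refine ⟨‖v‖⁻¹ • v, ?_, ?_⟩
    · rw [norm_smul, norm_inv, norm_norm, inv_mul_cancel₀ (norm_ne_zero_iff.2 hv)]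
    · rw [smul_smul, mul_inv_cancel₀ (norm_ne_zero_iff.2 hv), one_smul]

section GaussianForms

variable {E : Type*} [NormedAddCommGroup E] [InnerProductSpace ℝ E] [FiniteDimensional ℝ E]

theorem norm_starProjection_sq_eq_sum (U : Submodule ℝ E) (ξ : E) :
    ‖U.starProjection ξ‖ ^ 2
      = ∑ i, ⟪((stdOrthonormalBasis ℝ U i : U) : E), ξ⟫ ^ 2 := by
  rw [Submodule.starProjection_apply, Submodule.norm_coe,
    ← (stdOrthonormalBasis ℝ U).sum_sq_norm_inner_right]
  refine Finset.sum_congr rfl fun i _ => ?_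
  rw [Real.norm_eq_abs, sq_abs, Submodule.coe_inner, ← Submodule.starProjection_apply,
    ← Submodule.inner_starProjection_left_eq_right,
    Submodule.starProjection_eq_self_iff.2 (Subtype.coe_prop _)]

theorem norm_coe_stdOrthonormalBasis (U : Submodule ℝ E) (i) :
    ‖((stdOrthonormalBasis ℝ U i : U) : E)‖ = 1 := by
  rw [Submodule.norm_coe]; simp

variable [MeasurableSpace E] [BorelSpace E]

theorem map_inner_stdGaussian {u : E} (hu : ‖u‖ = 1) :
    (stdGaussian E).map (fun ξ => ⟪u, ξ⟫) = gaussianReal 0 1 := by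
  apply Measure.ext_of_charFun
  ext t
  have h := charFun_map_stdGaussian (innerSL ℝ u) t
  have h1 : ContinuousLinearMap.adjoint (innerSL ℝ u) t = t • u := by
    refine ext_inner_left ℝ fun v => ?_
    rw [ContinuousLinearMap.adjoint_inner_right]
    simp [inner_smul_right, real_inner_comm]
  rw [h1] at h
  have h2 : (fun ξ => ⟪u, ξ⟫) = ⇑(innerSL ℝ u) := rfl
  rw [h2, h, charFun_gaussianReal, norm_smul, hu]
  congr 1
  simp [← Complex.ofReal_pow]

theorem integrable_sq_gaussianReal : Integrable (fun x : ℝ => x ^ 2) (gaussianReal 0 1) :=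
  (memLp_id_gaussianReal 2).integrable_sq

theorem integral_sq_gaussianReal : ∫ x, x ^ 2 ∂(gaussianReal 0 1) = 1 := by
  have h := variance_id_gaussianReal (μ := 0) (v := 1)
  rw [variance_eq_integral (by fun_prop)] at h
  simpa using h

theorem integrable_inner_sq_stdGaussian {u : E} (hu : ‖u‖ = 1) :
    Integrable (fun ξ => ⟪u, ξ⟫ ^ 2) (stdGaussian E) := by
  have := integrable_sq_gaussianReal
  rw [← map_inner_stdGaussian hu, integrable_map_measure (by fun_prop) (by fun_prop)] at this
  exact this

theorem integral_inner_sq_stdGaussian {u : E} (hu : ‖u‖ = 1) :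
    ∫ ξ, ⟪u, ξ⟫ ^ 2 ∂(stdGaussian E) = 1 := by
  have := integral_sq_gaussianReal
  rw [← map_inner_stdGaussian hu, integral_map (by fun_prop) (by fun_prop)] at this
  exact this

theorem integrable_abs_inner_stdGaussian (u : E) :
    Integrable (fun ξ => |⟪u, ξ⟫|) (stdGaussian E) := by
  have h : Integrable (fun ξ : E => ξ) (stdGaussian E) := IsGaussian.integrable_id
  exact ((innerSL ℝ u).integrable_comp h).abs

theorem integral_abs_inner_stdGaussian_le {u : E} (hu : ‖u‖ = 1) :
    ∫ ξ, |⟪u, ξ⟫| ∂(stdGaussian E) ≤ 1 := by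
  have h1 : ∫ ξ, |⟪u, ξ⟫| ∂(stdGaussian E) ≤ ∫ ξ, (1 + ⟪u, ξ⟫ ^ 2) / 2 ∂(stdGaussian E) := by
    refine integral_mono (integrable_abs_inner_stdGaussian u)
      (((integrable_const _).add (integrable_inner_sq_stdGaussian hu)).div_const 2) fun ξ => ?_
    beta_reduce
    nlinarith [sq_nonneg (|⟪u, ξ⟫| - 1), sq_abs ⟪u, ξ⟫]
  rw [integral_div, integral_add (integrable_const _) (integrable_inner_sq_stdGaussian hu),
    integral_inner_sq_stdGaussian hu] at h1
  simpa using h1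

theorem integrable_norm_starProjection_sq (U : Submodule ℝ E) :
    Integrable (fun ξ => ‖U.starProjection ξ‖ ^ 2) (stdGaussian E) := by
  simp_rw [norm_starProjection_sq_eq_sum]
  exact integrable_finsetSum _ fun i _ =>
    integrable_inner_sq_stdGaussian (norm_coe_stdOrthonormalBasis U i)

theorem integral_norm_starProjection_sq (U : Submodule ℝ E) :
    ∫ ξ, ‖U.starProjection ξ‖ ^ 2 ∂(stdGaussian E) = Module.finrank ℝ U := by
  simp_rw [norm_starProjection_sq_eq_sum]
  rw [integral_finsetSum _ fun i _ =>
    integrable_inner_sq_stdGaussian (norm_coe_stdOrthonormalBasis U i)]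
  simp [integral_inner_sq_stdGaussian (norm_coe_stdOrthonormalBasis U _)]

end GaussianForms

theorem finrank_sieve_le (n k : ℕ) : Module.finrank ℝ (sieve n k) ≤ k := by
  have h := finrank_range_le_card (R := ℝ)
    (fun j : Fin k => designValues n (trigBasis ((j : ℕ) + 1)))
  rw [Fintype.card_fin] at h
  exact h

theorem integral_norm_proj_sq_le (n k : ℕ) :
    ∫ ξ, ‖proj n k ξ‖ ^ 2 ∂(stdGaussian (EuclideanSpace ℝ (Fin n))) ≤ k := by
  unfold proj
  rw [integral_norm_starProjection_sq]
  exact_mod_cast finrank_sieve_le n k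

/-! ### Coupling bounds for the interval distance -/

/-- The standard Gaussian density is at most `1/√(2π) ≤ 1`. -/
theorem gaussianReal_le_volume (s : Set ℝ) : gaussianReal 0 1 s ≤ volume s := by
  rw [gaussianReal_of_var_ne_zero _ one_ne_zero]
  calc (volume.withDensity (gaussianPDF 0 1)) s ≤ (volume.withDensity 1) s := by
        refine withDensity_mono (ae_of_all _ fun x => ?_) s
        rw [gaussianPDF, gaussianPDFReal]
        refine ENNReal.ofReal_le_one.2 (mul_le_one₀ ?_ (Real.exp_pos _).le ?_)
        · refine inv_le_one_of_one_le₀ (Real.one_le_sqrt.2 ?_)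
          have := Real.pi_gt_three
          simp only [NNReal.coe_one, mul_one]
          linarith
        · refine Real.exp_le_one_iff.2 ?_
          have : 0 ≤ (x - 0) ^ 2 / (2 * ((1 : NNReal) : ℝ)) := by positivity
          rw [neg_div]
          linarith
    _ = volume s := by rw [withDensity_one]

theorem volume_le_of_forall_sub_le {s : Set ℝ} {δ : ℝ}
    (h : ∀ x ∈ s, ∀ y ∈ s, x < y → y - x ≤ δ) (hδ : 0 ≤ δ) : volume s ≤ ENNReal.ofReal δ := by
  refine (Real.volume_le_diam s).trans (Metric.ediam_le fun x hx y hy => ?_)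
  rw [edist_dist, Real.dist_eq]
  refine ENNReal.ofReal_le_ofReal ?_
  rcases lt_trichotomy x y with hxy | hxy | hxy
  · rw [abs_of_neg (by linarith)]; linarith [h x hx y hy hxy]
  · simpa [hxy] using hδ
  · rw [abs_of_pos (by linarith)]; exact h y hy x hx hxy

/-- The points outside `I` at distance at most `δ` from `I`. -/
def outerLayer (I : Set ℝ) (δ : ℝ) : Set ℝ := {z | z ∉ I ∧ ∃ w ∈ I, |w - z| ≤ δ}

/-- The layer has a left and a right part. Two points of the same part more than `δ` apart would
place one of them between two points of `I`, hence in `I`. -/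
theorem volume_outerLayer_le {I : Set ℝ} (hI : I.OrdConnected) {δ : ℝ} (hδ : 0 ≤ δ) :
    volume (outerLayer I δ) ≤ ENNReal.ofReal (2 * δ) := by
  have hsub : outerLayer I δ ⊆
      {z | z ∉ I ∧ ∃ w ∈ I, z < w ∧ w - z ≤ δ} ∪ {z | z ∉ I ∧ ∃ w ∈ I, w < z ∧ z - w ≤ δ} := by
    rintro z ⟨hz, w, hw, hwz⟩
    rcases lt_trichotomy w z with h | h | h
    · exact Or.inr ⟨hz, w, hw, h, by linarith [neg_abs_le (w - z)]⟩
    · exact absurd (h ▸ hw) hz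
    · exact Or.inl ⟨hz, w, hw, h, by linarith [le_abs_self (w - z)]⟩
  refine (measure_mono hsub).trans ((measure_union_le _ _).trans ?_)
  rw [two_mul, ENNReal.ofReal_add hδ hδ]
  refine add_le_add (volume_le_of_forall_sub_le ?_ hδ) (volume_le_of_forall_sub_le ?_ hδ)
  · rintro x ⟨_, w, hw, _, hwx⟩ y ⟨hy, w', hw', hyw', _⟩ hxy
    by_contra hcon
    exact hy (hI.out hw hw' ⟨by linarith, hyw'.le⟩)
  · rintro x ⟨hx, w, hw, hwx, _⟩ y ⟨_, w', hw', _, hyw'⟩ hxy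
    by_contra hcon
    exact hx (hI.out hw hw' ⟨hwx.le, by linarith⟩)

/-- The points of `I` at distance at most `δ` from the complement of `I`. -/
def innerLayer (I : Set ℝ) (δ : ℝ) : Set ℝ := {z | z ∈ I ∧ ∃ w ∉ I, |w - z| ≤ δ}

/-- Here two points of one part more than `δ` apart would trap a witness outside `I` between two
points of `I`. -/
theorem volume_innerLayer_le {I : Set ℝ} (hI : I.OrdConnected) {δ : ℝ} (hδ : 0 ≤ δ) :
    volume (innerLayer I δ) ≤ ENNReal.ofReal (2 * δ) := by
  have hsub : innerLayer I δ ⊆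
      {z | z ∈ I ∧ ∃ w ∉ I, z < w ∧ w - z ≤ δ} ∪ {z | z ∈ I ∧ ∃ w ∉ I, w < z ∧ z - w ≤ δ} := by
    rintro z ⟨hz, w, hw, hwz⟩
    rcases lt_trichotomy w z with h | h | h
    · exact Or.inr ⟨hz, w, hw, h, by linarith [neg_abs_le (w - z)]⟩
    · exact absurd hz (h ▸ hw)
    · exact Or.inl ⟨hz, w, hw, h, by linarith [le_abs_self (w - z)]⟩
  refine (measure_mono hsub).trans ((measure_union_le _ _).trans ?_)
  rw [two_mul, ENNReal.ofReal_add hδ hδ]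
  refine add_le_add (volume_le_of_forall_sub_le ?_ hδ) (volume_le_of_forall_sub_le ?_ hδ)
  · rintro x ⟨hx, w, hw, hxw, hwx⟩ y ⟨hy, w', hw', hyw', _⟩ hxy
    by_contra hcon
    exact hw (hI.out hx hy ⟨hxw.le, by linarith⟩)
  · rintro x ⟨hx, w, hw, hwx, _⟩ y ⟨hy, w', hw', hwy, hyw'⟩ hxy
    by_contra hcon
    exact hw' (hI.out hx hy ⟨by linarith, hwy.le⟩)

section Coupling

variable {Ω : Type*} [MeasurableSpace Ω] {μ : Measure Ω} {X Z : Ω → ℝ}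

theorem real_abs_sub_gt_le (hint : Integrable (fun ω => |X ω - Z ω|) μ) {δ : ℝ} (hδ : 0 < δ) :
    μ.real {ω | δ ≤ |X ω - Z ω|} ≤ (∫ ω, |X ω - Z ω| ∂μ) / δ := by
  rw [le_div_iff₀ hδ, mul_comm]
  exact mul_meas_ge_le_integral_of_nonneg (ae_of_all _ fun _ => abs_nonneg _) hint δ

/-- If exactly one of `X`, `Z` lies in `I`, then either `|X - Z| ≥ δ`, which Markov's inequality
controls, or `Z` lies within `δ` of the boundary of `I`, in a set of length at most `2δ`. The bound
is uniform in `I`. -/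
theorem intervalDist_le_of_coupling [IsProbabilityMeasure μ] (hX : Measurable X) (hZ : Measurable Z)
    (hZ1 : μ.map Z = gaussianReal 0 1)
    (hint : Integrable (fun ω => |X ω - Z ω|) μ) {δ : ℝ} (hδ : 0 < δ) :
    intervalDist (μ.map X) (gaussianReal 0 1)
      ≤ ENNReal.ofReal ((∫ ω, |X ω - Z ω| ∂μ) / δ + 2 * δ) := by
  refine iSup₂_le fun I hI => ENNReal.ofReal_le_ofReal ?_
  have hmark := real_abs_sub_gt_le hint hδ
  have hImeas : MeasurableSet I := hI.measurableSet
  have key : ∀ {S : Set ℝ}, volume S ≤ ENNReal.ofReal (2 * δ) → μ.real (Z ⁻¹' S) ≤ 2 * δ := by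
    intro S hS
    refine ENNReal.toReal_le_of_le_ofReal (by positivity) ?_
    calc μ (Z ⁻¹' S) ≤ μ.map Z S := Measure.le_map_apply hZ.aemeasurable S
      _ ≤ volume S := by rw [hZ1]; exact gaussianReal_le_volume S
      _ ≤ _ := hS
  rw [← hZ1, map_measureReal_apply hX hImeas, map_measureReal_apply hZ hImeas, abs_sub_le_iff]
  constructor
  · have h1 : X ⁻¹' I ⊆ Z ⁻¹' I ∪ ({ω | δ ≤ |X ω - Z ω|} ∪ Z ⁻¹' outerLayer I δ) := by
      intro ω hω
      by_cases h2 : Z ω ∈ I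
      · exact Or.inl h2
      · by_cases h3 : δ ≤ |X ω - Z ω|
        · exact Or.inr (Or.inl h3)
        · exact Or.inr (Or.inr ⟨h2, X ω, hω, by linarith⟩)
    have h2 := (measureReal_mono (μ := μ) h1).trans (measureReal_union_le _ _)
    have h3 := measureReal_union_le (μ := μ) {ω | δ ≤ |X ω - Z ω|} (Z ⁻¹' outerLayer I δ)
    linarith [key (volume_outerLayer_le hI hδ.le)]
  · have h1 : Z ⁻¹' I ⊆ X ⁻¹' I ∪ ({ω | δ ≤ |X ω - Z ω|} ∪ Z ⁻¹' innerLayer I δ) := by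
      intro ω hω
      by_cases h2 : X ω ∈ I
      · exact Or.inl h2
      · by_cases h3 : δ ≤ |X ω - Z ω|
        · exact Or.inr (Or.inl h3)
        · exact Or.inr (Or.inr ⟨hω, X ω, h2, by linarith⟩)
    have h2 := (measureReal_mono (μ := μ) h1).trans (measureReal_union_le _ _)
    have h3 := measureReal_union_le (μ := μ) {ω | δ ≤ |X ω - Z ω|} (Z ⁻¹' innerLayer I δ)
    linarith [key (volume_innerLayer_le hI hδ.le)]

end Coupling

/-- Convergence in distribution from a coupling with the limit that converges in `L¹`. -/
theorem tendstoInDistribution_of_coupling {Ω : ℕ → Type*} [∀ n, MeasurableSpace (Ω n)]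
    {μ : ∀ n, Measure (Ω n)} [∀ n, IsProbabilityMeasure (μ n)] {X : ∀ n, Ω n → ℝ}
    (hX : ∀ n, Measurable (X n)) {b : ℕ → ℝ} (hb : Tendsto b atTop (𝓝 0))
    (h : ∀ᶠ n in atTop, ∃ Z : Ω n → ℝ, Measurable Z ∧ (μ n).map Z = gaussianReal 0 1 ∧
      Integrable (fun ω => |X n ω - Z ω|) (μ n) ∧ ∫ ω, |X n ω - Z ω| ∂(μ n) ≤ b n) :
    TendstoInDistribution X atTop (id : ℝ → ℝ) μ (gaussianReal 0 1) where
  forall_aemeasurable n := (hX n).aemeasurable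
  aemeasurable_limit := aemeasurable_id
  tendsto := by
    refine tendsto_iff_forall_lipschitz_integral_tendsto.2 ?_
    rintro g ⟨C, hC⟩ ⟨K, hK⟩
    have hgb : ∀ x, ‖g x‖ ≤ ‖g 0‖ + C := fun x => by
      have := norm_le_norm_add_norm_sub' (g x) (g 0)
      have h2 := hC x 0
      rw [dist_eq_norm] at h2
      linarith
    have hgm : Measurable g := hK.continuous.measurable
    have hlim : Tendsto (fun n => (K : ℝ) * b n) atTop (𝓝 0) := by
      simpa using hb.const_mul (K : ℝ)
    rw [tendsto_iff_norm_sub_tendsto_zero]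
    refine squeeze_zero' (Eventually.of_forall fun n => norm_nonneg _) ?_ hlim
    filter_upwards [h] with n ⟨Z, hZ, hZ1, hint, hle⟩
    have hi : ∀ {W : Ω n → ℝ}, Measurable W → Integrable (fun ω => g (W ω)) (μ n) := fun hW =>
      Integrable.of_bound (hgm.comp hW).aestronglyMeasurable _ (ae_of_all _ fun ω => hgb _)
    simp only [ProbabilityMeasure.coe_mk, Measure.map_id]
    rw [← hZ1, integral_map (hX n).aemeasurable hgm.aestronglyMeasurable,
      integral_map hZ.aemeasurable hgm.aestronglyMeasurable, ← integral_sub (hi (hX n)) (hi hZ)]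
    refine (norm_integral_le_integral_norm _).trans ?_
    calc ∫ ω, ‖g (X n ω) - g (Z ω)‖ ∂(μ n) ≤ ∫ ω, (K : ℝ) * |X n ω - Z ω| ∂(μ n) := by
          refine integral_mono ((hi (hX n)).sub (hi hZ)).norm (hint.const_mul _) fun ω => ?_
          have := hK.dist_le_mul (X n ω) (Z ω)
          rwa [dist_eq_norm, Real.dist_eq] at this
      _ = (K : ℝ) * ∫ ω, |X n ω - Z ω| ∂(μ n) := integral_const_mul _ _
      _ ≤ (K : ℝ) * b n := mul_le_mul_of_nonneg_left hle K.coe_nonneg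

/-! ### Orthogonality of the trigonometric system -/

theorem trigBasis_one (x : ℝ) : trigBasis 1 x = 1 := by simp [trigBasis]

theorem trigBasis_of_even {j : ℕ} (hj : Even j) (x : ℝ) :
    trigBasis j x = √2 * Real.cos (2 * Real.pi * ((j / 2 : ℕ) : ℝ) * x) := by
  have : j ≠ 1 := by rintro rfl; exact absurd hj (by decide)
  simp [trigBasis, hj, this]

theorem trigBasis_of_odd {j : ℕ} (hj : ¬ Even j) (h1 : j ≠ 1) (x : ℝ) :
    trigBasis j x = √2 * Real.sin (2 * Real.pi * ((j / 2 : ℕ) : ℝ) * x) := by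
  simp [trigBasis, hj, h1]

theorem continuous_trigBasis (j : ℕ) : Continuous (trigBasis j) := by
  by_cases h1 : j = 1
  · subst h1
    exact continuous_const.congr fun x => (trigBasis_one x).symm
  by_cases h2 : Even j
  · have : Continuous fun x : ℝ => √2 * Real.cos (2 * Real.pi * ((j / 2 : ℕ) : ℝ) * x) := by
      fun_prop
    exact this.congr fun x => (trigBasis_of_even h2 x).symm
  · have : Continuous fun x : ℝ => √2 * Real.sin (2 * Real.pi * ((j / 2 : ℕ) : ℝ) * x) := by
      fun_prop
    exact this.congr fun x => (trigBasis_of_odd h2 h1 x).symm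

theorem abs_trigBasis_le (j : ℕ) (x : ℝ) : |trigBasis j x| ≤ 2 := by
  have h2 : √2 ≤ 2 := by
    rw [Real.sqrt_le_left (by norm_num)]; norm_num
  by_cases h1 : j = 1
  · subst h1
    rw [trigBasis_one]; norm_num
  by_cases he : Even j
  · rw [trigBasis_of_even he, abs_mul, abs_of_nonneg (Real.sqrt_nonneg 2)]
    nlinarith [Real.abs_cos_le_one (2 * Real.pi * ((j / 2 : ℕ) : ℝ) * x), Real.sqrt_nonneg 2]
  · rw [trigBasis_of_odd he h1, abs_mul, abs_of_nonneg (Real.sqrt_nonneg 2)]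
    nlinarith [Real.abs_sin_le_one (2 * Real.pi * ((j / 2 : ℕ) : ℝ) * x), Real.sqrt_nonneg 2]

/-- Orthonormality of the trigonometric system for a probability measure whose Fourier
coefficients of nonzero frequency less than `M` vanish. -/
theorem integral_trigBasis_mul {μ : Measure ℝ} [IsProbabilityMeasure μ] {M : ℕ}
    (hcos : ∀ m : ℤ, m ≠ 0 → |m| < M → ∫ x, Real.cos (2 * Real.pi * (m : ℝ) * x) ∂μ = 0)
    (hsin : ∀ m : ℤ, |m| < M → ∫ x, Real.sin (2 * Real.pi * (m : ℝ) * x) ∂μ = 0)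
    {i j : ℕ} (hi : 1 ≤ i) (hj : 1 ≤ j) (hij : i / 2 + j / 2 < M) :
    ∫ x, trigBasis i x * trigBasis j x ∂μ = if i = j then 1 else 0 := by
  have ic : ∀ m : ℤ, Integrable (fun x => Real.cos (2 * Real.pi * (m : ℝ) * x)) μ := fun m =>
    Integrable.of_bound (by fun_prop) 1 (ae_of_all _ fun x => Real.abs_cos_le_one _)
  have is : ∀ m : ℤ, Integrable (fun x => Real.sin (2 * Real.pi * (m : ℝ) * x)) μ := fun m =>
    Integrable.of_bound (by fun_prop) 1 (ae_of_all _ fun x => Real.abs_sin_le_one _)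
  have hC : ∀ m : ℤ, |m| < M →
      ∫ x, Real.cos (2 * Real.pi * (m : ℝ) * x) ∂μ = if m = 0 then 1 else 0 := fun m hm => by
    split_ifs with h
    · simp [h]
    · exact hcos m h hm
  have h2 : √2 * √2 = (2 : ℝ) := Real.mul_self_sqrt (by norm_num)
  have cc : ∀ p q : ℕ, ∀ x : ℝ, (√2 * Real.cos (2 * Real.pi * (p : ℝ) * x)) *
      (√2 * Real.cos (2 * Real.pi * (q : ℝ) * x)) =
      Real.cos (2 * Real.pi * ((p - q : ℤ) : ℝ) * x)
        + Real.cos (2 * Real.pi * ((p + q : ℤ) : ℝ) * x) := fun p q x => by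
    push_cast
    rw [mul_sub, mul_add, sub_mul, add_mul, Real.cos_sub, Real.cos_add]
    linear_combination (Real.cos (2 * Real.pi * (p : ℝ) * x) *
      Real.cos (2 * Real.pi * (q : ℝ) * x)) * h2
  have ss : ∀ p q : ℕ, ∀ x : ℝ, (√2 * Real.sin (2 * Real.pi * (p : ℝ) * x)) *
      (√2 * Real.sin (2 * Real.pi * (q : ℝ) * x)) =
      Real.cos (2 * Real.pi * ((p - q : ℤ) : ℝ) * x)
        - Real.cos (2 * Real.pi * ((p + q : ℤ) : ℝ) * x) := fun p q x => by
    push_cast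
    rw [mul_sub, mul_add, sub_mul, add_mul, Real.cos_sub, Real.cos_add]
    linear_combination (Real.sin (2 * Real.pi * (p : ℝ) * x) *
      Real.sin (2 * Real.pi * (q : ℝ) * x)) * h2
  have sc : ∀ p q : ℕ, ∀ x : ℝ, (√2 * Real.sin (2 * Real.pi * (p : ℝ) * x)) *
      (√2 * Real.cos (2 * Real.pi * (q : ℝ) * x)) =
      Real.sin (2 * Real.pi * ((p - q : ℤ) : ℝ) * x)
        + Real.sin (2 * Real.pi * ((p + q : ℤ) : ℝ) * x) := fun p q x => by
    push_cast
    rw [mul_sub, mul_add, sub_mul, add_mul, Real.sin_sub, Real.sin_add]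
    linear_combination (Real.sin (2 * Real.pi * (p : ℝ) * x) *
      Real.cos (2 * Real.pi * (q : ℝ) * x)) * h2
  have Isc : ∀ p q : ℕ, p + q < M → ∫ x, (√2 * Real.sin (2 * Real.pi * (p : ℝ) * x)) *
      (√2 * Real.cos (2 * Real.pi * (q : ℝ) * x)) ∂μ = 0 := fun p q h => by
    simp_rw [sc]
    rw [integral_add (is _) (is _), hsin _ (by rw [abs_lt]; omega),
      hsin _ (by rw [abs_lt]; omega), add_zero]
  have Ic : ∀ p : ℕ, p ≠ 0 → p < M → ∫ x, √2 * Real.cos (2 * Real.pi * (p : ℝ) * x) ∂μ = 0 :=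
    fun p h0 h => by
      have := hcos p (by exact_mod_cast h0) (by rw [abs_lt]; omega)
      push_cast at this
      rw [integral_const_mul, this, mul_zero]
  have Is : ∀ p : ℕ, p < M → ∫ x, √2 * Real.sin (2 * Real.pi * (p : ℝ) * x) ∂μ = 0 :=
    fun p h => by
      have := hsin p (by rw [abs_lt]; omega)
      push_cast at this
      rw [integral_const_mul, this, mul_zero]
  rcases eq_or_ne i 1 with rfl | hi1
  · rcases eq_or_ne j 1 with rfl | hj1
    · simp [trigBasis_one]
    rw [if_neg (Ne.symm hj1)]
    by_cases hje : Even j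
    · simp_rw [trigBasis_one, trigBasis_of_even hje, one_mul]
      exact Ic _ (by omega) (by omega)
    · simp_rw [trigBasis_one, trigBasis_of_odd hje hj1, one_mul]
      exact Is _ (by omega)
  rcases eq_or_ne j 1 with rfl | hj1
  · rw [if_neg hi1]
    by_cases hie : Even i
    · simp_rw [trigBasis_one, trigBasis_of_even hie, mul_one]
      exact Ic _ (by omega) (by omega)
    · simp_rw [trigBasis_one, trigBasis_of_odd hie hi1, mul_one]
      exact Is _ (by omega)
  by_cases hie : Even i <;> by_cases hje : Even j
  · simp_rw [trigBasis_of_even hie, trigBasis_of_even hje, cc]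
    rw [integral_add (ic _) (ic _), hC _ (by rw [abs_lt]; omega), hC _ (by rw [abs_lt]; omega)]
    rw [Nat.even_iff] at hie hje
    -- Both indices are at least 2, so the sum of the frequencies is positive; for equal parity
    -- their difference vanishes exactly when `i = j`.
    rw [if_neg (c := ((i / 2 : ℕ) : ℤ) + ((j / 2 : ℕ) : ℤ) = 0) (by omega), add_zero]
    exact if_congr (by omega) rfl rfl
  · simp_rw [trigBasis_of_even hie, trigBasis_of_odd hje hj1]
    rw [if_neg (by rintro rfl; exact hje hie)]
    have := Isc (j / 2) (i / 2) (by omega)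
    rw [← this]
    exact integral_congr_ae (ae_of_all _ fun x => mul_comm _ _)
  · simp_rw [trigBasis_of_odd hie hi1, trigBasis_of_even hje]
    rw [if_neg (by rintro rfl; exact hie hje)]
    exact Isc _ _ hij
  · simp_rw [trigBasis_of_odd hie hi1, trigBasis_of_odd hje hj1, ss]
    rw [integral_sub (ic _) (ic _), hC _ (by rw [abs_lt]; omega), hC _ (by rw [abs_lt]; omega)]
    rw [Nat.even_iff] at hie hje
    rw [if_neg (c := ((i / 2 : ℕ) : ℤ) + ((j / 2 : ℕ) : ℤ) = 0) (by omega), sub_zero]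
    exact if_congr (by omega) rfl rfl

theorem integral_trigBasis_mul_unitInterval {i j : ℕ} (hi : 1 ≤ i) (hj : 1 ≤ j) :
    ∫ x in Set.Icc (0 : ℝ) 1, trigBasis i x * trigBasis j x = if i = j then 1 else 0 := by
  have : IsProbabilityMeasure (volume.restrict (Set.Icc (0 : ℝ) 1)) := ⟨by simp⟩
  have hne : ∀ m : ℤ, m ≠ 0 → 2 * Real.pi * (m : ℝ) ≠ 0 := fun m hm => by
    have := Real.pi_ne_zero
    have : (m : ℝ) ≠ 0 := by exact_mod_cast hm
    positivity
  have hconv : ∀ g : ℝ → ℝ, ∫ x in Set.Icc (0 : ℝ) 1, g x = ∫ x in (0 : ℝ)..1, g x := fun g => by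
    rw [intervalIntegral.integral_of_le zero_le_one, integral_Icc_eq_integral_Ioc]
  -- Lebesgue measure annihilates every nonzero frequency, so any `M` above the sum of the two
  -- frequencies will do.
  refine integral_trigBasis_mul (M := i / 2 + j / 2 + 1) (fun m hm _ => ?_) (fun m _ => ?_) hi hj
    (Nat.lt_succ_self _)
  · rw [hconv, intervalIntegral.integral_comp_mul_left (fun x => Real.cos x) (hne m hm),
      integral_cos]
    have : Real.sin (2 * Real.pi * (m : ℝ) * 1) = 0 := by
      rw [mul_one, show 2 * Real.pi * (m : ℝ) = ((2 * m : ℤ) : ℝ) * Real.pi by push_cast; ring]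
      exact Real.sin_int_mul_pi _
    rw [this]
    simp
  · rcases eq_or_ne m 0 with rfl | hm
    · simp
    rw [hconv, intervalIntegral.integral_comp_mul_left (fun x => Real.sin x) (hne m hm),
      integral_sin]
    have : Real.cos (2 * Real.pi * (m : ℝ) * 1) = 1 := by
      rw [mul_one, show 2 * Real.pi * (m : ℝ) = (m : ℝ) * (2 * Real.pi) by ring]
      exact Real.cos_int_mul_two_pi _
    rw [this]
    simp

/-! ### The regular design -/

/-- The design point `(i + 1) / n`. -/
noncomputable def designPoint (n : ℕ) (i : Fin n) : ℝ := ((i : ℕ) + 1 : ℝ) / (n : ℝ)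

theorem designValues_apply (n : ℕ) (g : ℝ → ℝ) (i : Fin n) :
    designValues n g i = g (designPoint n i) := rfl

theorem inner_designValues (n : ℕ) (g h : ℝ → ℝ) :
    ⟪designValues n g, designValues n h⟫
      = ∑ i, g (designPoint n i) * h (designPoint n i) := by
  rw [PiLp.inner_apply]
  refine Finset.sum_congr rfl fun i _ => ?_
  simp [designValues_apply, mul_comm]

/-- The complex exponential `exp(2πimx)`. -/
noncomputable def cexpFreq (m : ℤ) (x : ℝ) : ℂ :=
  Complex.exp (((2 * Real.pi * (m : ℝ) * x : ℝ) : ℂ) * Complex.I)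

theorem cexpFreq_re (m : ℤ) (x : ℝ) : (cexpFreq m x).re = Real.cos (2 * Real.pi * (m : ℝ) * x) :=
  Complex.exp_ofReal_mul_I_re _

theorem cexpFreq_im (m : ℤ) (x : ℝ) : (cexpFreq m x).im = Real.sin (2 * Real.pi * (m : ℝ) * x) :=
  Complex.exp_ofReal_mul_I_im _

theorem cexpFreq_mul_conj (m l : ℤ) (x : ℝ) :
    cexpFreq m x * (starRingEnd ℂ) (cexpFreq l x) = cexpFreq (m - l) x := by
  simp only [cexpFreq, ← Complex.exp_conj, ← Complex.exp_add]
  congr 1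
  simp only [map_mul, Complex.conj_ofReal, Complex.conj_I]
  push_cast
  ring

/-- A geometric sum of powers of an `n`-th root of unity, which equals 1 exactly when `n` divides
`m`. The design starts at `1/n`, hence the extra factor `z` in `hterm`. -/
theorem sum_cexpFreq {n : ℕ} (hn : n ≠ 0) (m : ℤ) :
    ∑ i : Fin n, cexpFreq m (designPoint n i) = if (n : ℤ) ∣ m then (n : ℂ) else 0 := by
  have hn' : (n : ℂ) ≠ 0 := by exact_mod_cast hn
  set z : ℂ := Complex.exp (2 * Real.pi * Complex.I * (m / n)) with hz
  have hterm : ∀ i : Fin n, cexpFreq m (designPoint n i) = z * z ^ (i : ℕ) := fun i => by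
    rw [← pow_succ', hz, ← Complex.exp_nat_mul, cexpFreq, designPoint]
    congr 1
    push_cast
    field_simp
  simp_rw [hterm]
  rw [← Finset.mul_sum, Fin.sum_univ_eq_sum_range (fun i => z ^ i)]
  have hzn : z ^ n = 1 := by
    rw [hz, ← Complex.exp_nat_mul, Complex.exp_eq_one_iff]
    exact ⟨m, by field_simp⟩
  have hz1 : z = 1 ↔ (n : ℤ) ∣ m := by
    rw [hz, Complex.exp_eq_one_iff]
    constructor
    · rintro ⟨k, hk⟩
      refine ⟨k, ?_⟩
      have h1 : (2 * Real.pi * Complex.I : ℂ) ≠ 0 := Complex.two_pi_I_ne_zero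
      have h2 : (m / n : ℂ) = k := by
        apply mul_left_cancel₀ h1
        rw [hk]; ring
      rw [div_eq_iff hn'] at h2
      have h3 : m = k * n := by exact_mod_cast h2
      rw [h3, mul_comm]
    · rintro ⟨k, rfl⟩
      refine ⟨k, ?_⟩
      push_cast
      field_simp
  split_ifs with h
  · simp [hz1.2 h]
  · have : z ≠ 1 := fun hh => h (hz1.1 hh)
    rw [geom_sum_eq this, hzn]
    simp

/-- The uniform distribution on the design points. -/
noncomputable def designMeasure (n : ℕ) : Measure ℝ :=
  (n : ℝ≥0∞)⁻¹ • ∑ i : Fin n, Measure.dirac (designPoint n i)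

theorem isProbabilityMeasure_designMeasure {n : ℕ} (hn : n ≠ 0) :
    IsProbabilityMeasure (designMeasure n) := by
  refine ⟨?_⟩
  simp only [designMeasure, Measure.smul_apply, Measure.finsetSum_apply, measure_univ,
    Finset.sum_const, Finset.card_univ, Fintype.card_fin, smul_eq_mul, nsmul_eq_mul, mul_one]
  exact ENNReal.inv_mul_cancel (by exact_mod_cast hn) (ENNReal.natCast_ne_top n)

theorem integral_designMeasure (n : ℕ) (g : ℝ → ℝ) :
    ∫ x, g x ∂(designMeasure n) = (n : ℝ)⁻¹ * ∑ i, g (designPoint n i) := by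
  rw [designMeasure, integral_smul_measure, integral_finsetSum_measure]
  · simp
  · intro i _
    exact integrable_dirac (by simp)

/-- Orthonormality for the uniform law on the design, where frequencies below `n` do not alias to 0.
Index `n` has to be excluded: for even `n`, `φ_n` equals `±√2` at the design points and has squared
norm `2n`. -/
theorem inner_designValues_trigBasis {n i j : ℕ} (hn : n ≠ 0) (hi : 1 ≤ i) (hj : 1 ≤ j)
    (hin : i < n) (hjn : j < n) :
    ⟪designValues n (trigBasis i), designValues n (trigBasis j)⟫ = if i = j then (n : ℝ) else 0 := by
  have := isProbabilityMeasure_designMeasure hn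
  have hn' : (n : ℝ) ≠ 0 := by exact_mod_cast hn
  have key : ∀ m : ℤ, m ≠ 0 → |m| < n → ∑ i : Fin n, cexpFreq m (designPoint n i) = 0 :=
    fun m hm hmn => by
      rw [sum_cexpFreq hn, if_neg]
      intro hd
      exact hm (Int.eq_zero_of_abs_lt_dvd hd hmn)
  have h := integral_trigBasis_mul (μ := designMeasure n) (M := n) (fun m hm hmn => ?_)
    (fun m hmn => ?_) hi hj (by omega)
  · rw [integral_designMeasure] at h
    rw [inner_designValues]
    rw [inv_mul_eq_iff_eq_mul₀ hn'] at h
    rw [h]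
    simp
  · have h1 := congrArg Complex.re (key m hm hmn)
    rw [Complex.re_sum] at h1
    simp_rw [cexpFreq_re] at h1
    rw [integral_designMeasure, h1]
    simp
  · rcases eq_or_ne m 0 with rfl | hm
    · simp
    have h1 := congrArg Complex.im (key m hm hmn)
    rw [Complex.im_sum] at h1
    simp_rw [cexpFreq_im] at h1
    rw [integral_designMeasure, h1]
    simp

theorem orthogonalDesign {n k : ℕ} (hk : k < n) : OrthogonalDesign n k := fun i j => by
  rw [inner_designValues_trigBasis (by omega) (by omega) (by omega) (by omega) (by omega)]
  exact if_congr (by rw [Fin.ext_iff]; omega) rfl rfl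

/-! ### Discrete norms of trigonometric sums over blocks of frequencies -/

theorem sum_normSq_cexpFreq {n : ℕ} (hn : n ≠ 0) (S : Finset ℕ) (b : ℕ → ℝ) (m : ℕ → ℤ)
    (hS : ∀ l ∈ S, ∀ l' ∈ S, l ≠ l' → ¬ (n : ℤ) ∣ m l - m l') :
    ∑ i : Fin n, Complex.normSq (∑ l ∈ S, (b l : ℂ) * cexpFreq (m l) (designPoint n i))
      = n * ∑ l ∈ S, b l ^ 2 := by
  have h : (∑ i : Fin n, (Complex.normSq
      (∑ l ∈ S, (b l : ℂ) * cexpFreq (m l) (designPoint n i)) : ℂ)) =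
      n * ∑ l ∈ S, (b l : ℂ) ^ 2 := by
    have h1 : ∀ x : ℝ, (Complex.normSq (∑ l ∈ S, (b l : ℂ) * cexpFreq (m l) x) : ℂ) =
        ∑ l ∈ S, ∑ l' ∈ S, ((b l : ℂ) * (b l' : ℂ)) * cexpFreq (m l - m l') x := fun x => by
      rw [← Complex.mul_conj, map_sum, Finset.sum_mul_sum]
      refine Finset.sum_congr rfl fun l _ => Finset.sum_congr rfl fun l' _ => ?_
      rw [map_mul, Complex.conj_ofReal, ← cexpFreq_mul_conj]
      ring
    simp_rw [h1]
    rw [Finset.sum_comm, Finset.mul_sum]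
    refine Finset.sum_congr rfl fun l hl => ?_
    rw [Finset.sum_comm]
    simp_rw [← Finset.mul_sum, sum_cexpFreq hn]
    rw [Finset.sum_eq_single l]
    · simp
      ring
    · intro l' hl' hne
      rw [if_neg (hS l hl l' hl' hne.symm), mul_zero]
    · exact fun h => absurd hl h
  exact_mod_cast h

/-- Products of real cosines or sines involve sums of frequencies, which `n` may divide;
exponentials involve only differences. Within one parity class of `B` the frequencies `l / 2` are
distinct and differ by less than `n`, so Parseval is exact. The values are `√2 (Re z + Im w)`, whose
square is at most `4 (|z|² + |w|²)`. -/
theorem norm_sum_block_sq_le {n : ℕ} (hn : n ≠ 0) (B : Finset ℕ) (θ : ℕ → ℝ)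
    (h2 : ∀ l ∈ B, 2 ≤ l) (hB : ∀ l ∈ B, ∀ l' ∈ B, l < l' + n) :
    ‖∑ l ∈ B, θ l • designValues n (trigBasis l)‖ ^ 2 ≤ 4 * n * ∑ l ∈ B, θ l ^ 2 := by
  have hE := sum_normSq_cexpFreq hn (B.filter fun l => Even l) θ (fun l => ((l / 2 : ℕ) : ℤ)) (by
    intro l hl l' hl' hne hd
    rw [Finset.mem_filter, Nat.even_iff] at hl hl'
    have h3 := hB l hl.1 l' hl'.1
    have h4 := hB l' hl'.1 l hl.1
    have := Int.eq_zero_of_abs_lt_dvd hd (by rw [abs_lt]; omega)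
    omega)
  have hO := sum_normSq_cexpFreq hn (B.filter fun l => ¬ Even l) θ (fun l => ((l / 2 : ℕ) : ℤ)) (by
    intro l hl l' hl' hne hd
    rw [Finset.mem_filter, Nat.even_iff] at hl hl'
    have h3 := hB l hl.1 l' hl'.1
    have h4 := hB l' hl'.1 l hl.1
    have := Int.eq_zero_of_abs_lt_dvd hd (by rw [abs_lt]; omega)
    omega)
  rw [EuclideanSpace.real_norm_sq_eq,
    ← Finset.sum_filter_add_sum_filter_not B (fun l => Even l) (fun l => θ l ^ 2),
    show ∀ a b : ℝ, 4 * (n : ℝ) * (a + b) = 4 * (n * a) + 4 * (n * b) by intros; ring, ← hE, ← hO,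
    Finset.mul_sum, Finset.mul_sum, ← Finset.sum_add_distrib]
  refine Finset.sum_le_sum fun i _ => ?_
  set x := designPoint n i
  have hval : (∑ l ∈ B, θ l • designValues n (trigBasis l)) i
      = √2 * (∑ l ∈ B.filter (fun l => Even l),
          (θ l : ℂ) * cexpFreq ((l / 2 : ℕ) : ℤ) x).re
        + √2 * (∑ l ∈ B.filter (fun l => ¬ Even l),
          (θ l : ℂ) * cexpFreq ((l / 2 : ℕ) : ℤ) x).im := by
    have h0 : (∑ l ∈ B, θ l • designValues n (trigBasis l)) i
        = ∑ l ∈ B, θ l * trigBasis l x := by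
      simp [designValues_apply, x]
    rw [h0, ← Finset.sum_filter_add_sum_filter_not B (fun l => Even l), Complex.re_sum,
      Complex.im_sum, Finset.mul_sum, Finset.mul_sum]
    congr 1
    · refine Finset.sum_congr rfl fun l hl => ?_
      rw [Finset.mem_filter] at hl
      rw [trigBasis_of_even hl.2, Complex.re_ofReal_mul, cexpFreq_re, Int.cast_natCast]
      ring
    · refine Finset.sum_congr rfl fun l hl => ?_
      rw [Finset.mem_filter] at hl
      have := h2 l hl.1
      rw [trigBasis_of_odd hl.2 (by omega), Complex.im_ofReal_mul, cexpFreq_im,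
        Int.cast_natCast]
      ring
  rw [hval]
  generalize (∑ l ∈ B.filter (fun l => Even l), (θ l : ℂ) * cexpFreq ((l / 2 : ℕ) : ℤ) x) = z
  generalize (∑ l ∈ B.filter (fun l => ¬ Even l), (θ l : ℂ) * cexpFreq ((l / 2 : ℕ) : ℤ) x) = w
  have hs : √2 ^ 2 = (2 : ℝ) := Real.sq_sqrt (by norm_num)
  rw [Complex.normSq_apply, Complex.normSq_apply, ← mul_add, mul_pow, hs]
  nlinarith [sq_nonneg (z.re - w.im), sq_nonneg z.im, sq_nonneg w.re]

/-! ### Fourier coefficients of Sobolev functions -/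

/-- The restriction of Lebesgue measure to the unit interval. -/
noncomputable abbrev unitMeasure : Measure ℝ := volume.restrict (Set.Icc (0 : ℝ) 1)

instance : IsProbabilityMeasure unitMeasure := ⟨by simp [unitMeasure]⟩

/-- The `N`-th partial sum of the Fourier series with coefficients `θ`. -/
noncomputable def partialSum (θ : ℕ → ℝ) (N : ℕ) (x : ℝ) : ℝ :=
  ∑ j ∈ Finset.range N, θ j * trigBasis j x

/-- Since `j - 1 ≥ j / 2` for `j ≥ 2`, the weights may be replaced by plain powers of the index. -/
theorem rpow_two_mul_le_sobolevWeight_sq {α : ℝ} (hα : 0 ≤ α) {j : ℕ} (hj : 2 ≤ j) :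
    (j : ℝ) ^ (2 * α) ≤ 2 ^ (2 * α) * sobolevWeight α j ^ 2 := by
  have hj' : (2 : ℝ) ≤ j := by exact_mod_cast hj
  have h1 : ((j : ℝ) / 2) ^ α ≤ sobolevWeight α j := by
    unfold sobolevWeight
    split_ifs
    · exact Real.rpow_le_rpow (by positivity) (by linarith) hα
    · exact Real.rpow_le_rpow (by positivity) (by linarith) hα
  have h2 : (j : ℝ) ^ (2 * α) = 2 ^ (2 * α) * (((j : ℝ) / 2) ^ α) ^ 2 := by
    rw [← Real.rpow_natCast, ← Real.rpow_mul (by positivity), Nat.cast_two, mul_comm α 2,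
      ← Real.mul_rpow (by positivity) (by positivity)]
    congr 1
    ring
  rw [h2]
  gcongr

theorem exists_coefficients {α L : ℝ} (hα : 1 / 2 < α) {f : ℝ → ℝ} (hf : f ∈ sobolevClass α L) :
    ∃ θ : ℕ → ℝ, θ 0 = 0 ∧ Summable (fun l : ℕ => (l : ℝ) ^ (2 * α) * θ l ^ 2) ∧
      Tendsto (fun N => eLpNorm (fun x => f x - partialSum θ N x) 2 unitMeasure) atTop (𝓝 0) := by
  obtain ⟨_, θ, ⟨_, hsum, _⟩, hlim⟩ := hf
  -- `trigBasis 0` is the nonzero constant `√2`, so sums over `range` are correct only once the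
  -- meaningless coefficient `θ 0` is set to 0.
  refine ⟨Function.update θ 0 0, by simp, ?_, ?_⟩
  -- Indices 0 and 1 are dropped: the weight comparison starts at 2, and two terms do not affect
  -- summability.
  · rw [← summable_nat_add_iff 2]
    refine Summable.of_nonneg_of_le (fun l => by positivity) (fun l => ?_)
      (((summable_nat_add_iff 1).2 hsum).mul_left (2 ^ (2 * α)))
    rw [Function.update_of_ne (by omega), ← mul_assoc]
    exact mul_le_mul_of_nonneg_right
      (rpow_two_mul_le_sobolevWeight_sq (by linarith) (by omega)) (sq_nonneg _)
  · rw [← tendsto_add_atTop_iff_nat 1]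
    refine hlim.congr fun N => ?_
    congr 1
    ext x
    congr 1
    rw [partialSum, Finset.range_eq_Ico, Finset.sum_eq_sum_Ico_succ_bot (by omega)]
    simp only [Function.update_self, zero_mul, zero_add]
    refine Finset.sum_congr (by ext; simp) fun j hj => ?_
    rw [Function.update_of_ne]
    simp at hj
    omega

section Coefficients

variable {α : ℝ} {θ : ℕ → ℝ}

theorem abs_coeff_le (h0 : θ 0 = 0) (l : ℕ) :
    |θ l| ≤ ((l : ℝ) ^ (-(2 * α)) + (l : ℝ) ^ (2 * α) * θ l ^ 2) / 2 := by
  rcases Nat.eq_zero_or_pos l with rfl | hl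
  · rw [h0]
    have : (0 : ℝ) ≤ ((0 : ℕ) : ℝ) ^ (-(2 * α)) := by positivity
    simp only [abs_zero]
    positivity
  · have hl' : (0 : ℝ) < l := by exact_mod_cast hl
    have h1 : (l : ℝ) ^ (2 * α) = ((l : ℝ) ^ α) ^ 2 := by
      rw [← Real.rpow_natCast, ← Real.rpow_mul hl'.le]; congr 1; push_cast; ring
    have h2 : (l : ℝ) ^ (-(2 * α)) = (((l : ℝ) ^ α)⁻¹) ^ 2 := by
      rw [Real.rpow_neg hl'.le, h1, inv_pow]
    have h3 : 0 < (l : ℝ) ^ α := Real.rpow_pos_of_pos hl' _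
    have h4 : ((l : ℝ) ^ α)⁻¹ * ((l : ℝ) ^ α * |θ l|) = |θ l| := by
      rw [← mul_assoc, inv_mul_cancel₀ h3.ne', one_mul]
    rw [h1, h2, ← sq_abs (θ l), ← mul_pow]
    nlinarith [two_mul_le_add_sq (((l : ℝ) ^ α)⁻¹) ((l : ℝ) ^ α * |θ l|)]

theorem summable_abs_coeff (hα : 1 / 2 < α) (h0 : θ 0 = 0)
    (hs : Summable (fun l : ℕ => (l : ℝ) ^ (2 * α) * θ l ^ 2)) : Summable (fun l => |θ l|) :=
  Summable.of_nonneg_of_le (fun _ => abs_nonneg _) (abs_coeff_le (α := α) h0)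
    (((Real.summable_nat_rpow.2 (by linarith)).add hs).div_const 2)

theorem norm_coeff_mul_trigBasis_le (l : ℕ) (x : ℝ) : ‖θ l * trigBasis l x‖ ≤ |θ l| * 2 := by
  rw [norm_mul, Real.norm_eq_abs]
  exact mul_le_mul_of_nonneg_left (abs_trigBasis_le l x) (abs_nonneg _)

theorem abs_partialSum_le (hs : Summable fun l => |θ l|) (N : ℕ) (x : ℝ) :
    |partialSum θ N x| ≤ ∑' l, |θ l| * 2 := by
  refine (Finset.abs_sum_le_sum_abs _ _).trans ?_
  refine (Finset.sum_le_sum fun l _ => norm_coeff_mul_trigBasis_le (θ := θ) l x).trans ?_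
  exact (hs.mul_right 2).sum_le_tsum _ fun l _ => by positivity

theorem continuous_partialSum (N : ℕ) : Continuous (partialSum θ N) := by
  have : Continuous fun x => ∑ j ∈ Finset.range N, θ j * trigBasis j x :=
    continuous_finsetSum _ fun j _ => continuous_const.mul (continuous_trigBasis j)
  exact this

/-- The sum of an absolutely convergent Fourier series. -/
noncomputable def fourierSum (θ : ℕ → ℝ) (x : ℝ) : ℝ := ∑' l, θ l * trigBasis l x

theorem continuous_fourierSum (hs : Summable fun l => |θ l|) : Continuous (fourierSum θ) :=
  continuous_tsum (fun l => continuous_const.mul (continuous_trigBasis l)) (hs.mul_right 2)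
    fun l x => norm_coeff_mul_trigBasis_le l x

theorem tendsto_partialSum (hs : Summable fun l => |θ l|) (x : ℝ) :
    Tendsto (fun N => partialSum θ N x) atTop (𝓝 (fourierSum θ x)) :=
  (Summable.of_norm_bounded (hs.mul_right 2)
    fun l => norm_coeff_mul_trigBasis_le l x).hasSum.tendsto_sum_nat

theorem tendstoUniformly_partialSum (hs : Summable fun l => |θ l|) :
    TendstoUniformly (partialSum θ) (fourierSum θ) atTop :=
  tendstoUniformly_tsum_nat (hs.mul_right 2) fun l x => norm_coeff_mul_trigBasis_le l x

/-- The partial sums converge to `f` in `L²` and uniformly to `fourierSum θ`, so the two agree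
almost everywhere, and everywhere on `[0,1]` by continuity. Pointwise equality is needed because the
design samples `f` at points. -/
theorem eqOn_fourierSum {f : ℝ → ℝ} (hs : Summable fun l => |θ l|)
    (hfm : AEStronglyMeasurable f unitMeasure) (hfc : ContinuousOn f (Set.Icc 0 1))
    (hlim : Tendsto (fun N => eLpNorm (fun x => f x - partialSum θ N x) 2 unitMeasure)
      atTop (𝓝 0)) : Set.EqOn f (fourierSum θ) (Set.Icc 0 1) := by
  have hgc := continuous_fourierSum hs
  have hlim2 : Tendsto (fun N => eLpNorm (fun x => partialSum θ N x - fourierSum θ x) 2 unitMeasure)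
      atTop (𝓝 0) := by
    rw [ENNReal.tendsto_nhds_zero]
    intro ε hε
    obtain ⟨r, hr0, hr⟩ : ∃ r : ℝ, 0 < r ∧ ENNReal.ofReal r ≤ ε := by
      obtain ⟨r, hr0, hr⟩ := ENNReal.lt_iff_exists_nnreal_btwn.1 hε
      exact ⟨r, by exact_mod_cast hr0, by simpa using hr.le⟩
    have h := Metric.tendstoUniformly_iff.1 (tendstoUniformly_partialSum hs) r hr0
    filter_upwards [h] with N hN
    refine (eLpNorm_le_of_ae_bound (C := r) (ae_of_all _ fun x => ?_)).trans ?_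
    · have := (hN x).le
      rwa [dist_comm, dist_eq_norm] at this
    · simpa using hr
  have hzero : eLpNorm (fun x => f x - fourierSum θ x) 2 unitMeasure = 0 := by
    have hsum := hlim.add hlim2
    rw [add_zero] at hsum
    refine le_antisymm (ge_of_tendsto' hsum fun N => ?_) zero_le
    have hadd := eLpNorm_add_le (p := 2) (μ := unitMeasure)
      (hfm.sub (continuous_partialSum (θ := θ) N).aestronglyMeasurable)
      ((continuous_partialSum (θ := θ) N).sub hgc).aestronglyMeasurable one_le_two
    refine le_trans (le_of_eq ?_) hadd
    congr 1
    ext x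
    simp
  have hm : AEStronglyMeasurable (fun x => f x - fourierSum θ x) unitMeasure :=
    hfm.sub hgc.aestronglyMeasurable
  rw [eLpNorm_eq_zero_iff hm two_ne_zero] at hzero
  refine Measure.eqOn_Icc_of_ae_eq volume zero_ne_one ?_ hfc hgc.continuousOn
  filter_upwards [hzero] with x hx
  exact sub_eq_zero.1 hx

theorem integral_partialSum_sq (h0 : θ 0 = 0) (N : ℕ) :
    ∫ x, partialSum θ N x ^ 2 ∂unitMeasure = ∑ j ∈ Finset.range N, θ j ^ 2 := by
  have hint : ∀ i j : ℕ, Integrable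
      (fun x => (θ i * trigBasis i x) * (θ j * trigBasis j x)) unitMeasure := fun i j =>
    Continuous.integrableOn_Icc (by
      have := continuous_trigBasis i
      have := continuous_trigBasis j
      fun_prop)
  simp_rw [partialSum, sq, Finset.sum_mul_sum]
  rw [integral_finsetSum _ fun i _ => integrable_finsetSum _ fun j _ => hint i j]
  refine Finset.sum_congr rfl fun i hi => ?_
  rw [integral_finsetSum _ fun j _ => hint i j]
  have hval : ∀ j ∈ Finset.range N, ∫ x, (θ i * trigBasis i x) * (θ j * trigBasis j x) ∂unitMeasure
      = if i = j then θ i * θ j else 0 := fun j _ => by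
    have h1 : ∀ x, (θ i * trigBasis i x) * (θ j * trigBasis j x)
        = (θ i * θ j) * (trigBasis i x * trigBasis j x) := fun x => by ring
    simp_rw [h1]
    rw [integral_const_mul]
    rcases Nat.eq_zero_or_pos i with rfl | hi
    · simp [h0]
    rcases Nat.eq_zero_or_pos j with rfl | hj
    · simp [h0]
    rw [integral_trigBasis_mul_unitInterval hi hj]
    simp
  rw [Finset.sum_congr rfl hval, Finset.sum_ite_eq, if_pos hi]

theorem hasSum_coeff_sq {f : ℝ → ℝ} (h0 : θ 0 = 0) (hs : Summable fun l => |θ l|)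
    (heq : Set.EqOn f (fourierSum θ) (Set.Icc 0 1)) :
    HasSum (fun l => θ l ^ 2) (∫ x in (0 : ℝ)..1, f x ^ 2) := by
  rw [hasSum_iff_tendsto_nat_of_nonneg fun _ => sq_nonneg _]
  have h1 : ∫ x in (0 : ℝ)..1, f x ^ 2 = ∫ x, fourierSum θ x ^ 2 ∂unitMeasure := by
    rw [intervalIntegral.integral_of_le zero_le_one, ← integral_Icc_eq_integral_Ioc]
    exact setIntegral_congr_fun measurableSet_Icc fun x hx => by simp only [heq hx]
  rw [h1]
  simp_rw [← integral_partialSum_sq h0]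
  refine tendsto_integral_of_dominated_convergence (fun _ => (∑' l, |θ l| * 2) ^ 2)
    (fun N => ((continuous_partialSum N).pow 2).aestronglyMeasurable) (integrable_const _)
    (fun N => ae_of_all _ fun x => ?_) (ae_of_all _ fun x => (tendsto_partialSum hs x).pow 2)
  rw [norm_pow, Real.norm_eq_abs]
  exact pow_le_pow_left₀ (abs_nonneg _) (abs_partialSum_le hs N x) 2

end Coefficients

/-! ### Aliasing and the bias -/

section Aliasing

variable {α : ℝ} {θ : ℕ → ℝ}

/-- In block `q` one has `l ≥ q n`, so `θ_l² ≤ (q n)^(-2α) l^(2α) θ_l²`. The inequality `4 w² V ≤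
(w² + V)²` then separates the two factors into terms summable over `q`: the first because `2α > 1`,
the second by the Sobolev condition. -/
theorem norm_sum_block_le (hα : 0 ≤ α) {n q : ℕ} (hn : 2 ≤ n) (hq : 1 ≤ q) :
    ‖∑ l ∈ Finset.Ico (q * n) ((q + 1) * n), θ l • designValues n (trigBasis l)‖
      ≤ √n * (n : ℝ) ^ (-α) * ((q : ℝ) ^ (-(2 * α))
        + ∑ l ∈ Finset.Ico (q * n) ((q + 1) * n), (l : ℝ) ^ (2 * α) * θ l ^ 2) := by
  set B := Finset.Ico (q * n) ((q + 1) * n) with hBdef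
  have hn0 : (0 : ℝ) < n := by exact_mod_cast (by omega : 0 < n)
  have hq0 : (0 : ℝ) < q := by exact_mod_cast hq
  have hqn : n ≤ q * n := Nat.le_mul_of_pos_left n hq
  have h1 := norm_sum_block_sq_le (n := n) (by omega) B θ
    (fun l hl => by rw [hBdef, Finset.mem_Ico] at hl; omega)
    (fun l hl l' hl' => by
      rw [hBdef, Finset.mem_Ico] at hl hl'
      have : (q + 1) * n = q * n + n := by ring
      omega)
  set V := ∑ l ∈ B, (l : ℝ) ^ (2 * α) * θ l ^ 2 with hV
  have hV0 : 0 ≤ V := Finset.sum_nonneg fun l _ => by positivity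
  set u : ℝ := (n : ℝ) ^ (-α) with hu
  set w : ℝ := (q : ℝ) ^ (-α) with hw
  have hu0 : 0 < u := Real.rpow_pos_of_pos hn0 _
  have hw0 : 0 < w := Real.rpow_pos_of_pos hq0 _
  have hw2 : (q : ℝ) ^ (-(2 * α)) = w ^ 2 := by
    rw [hw, ← Real.rpow_natCast, ← Real.rpow_mul hq0.le]; congr 1; push_cast; ring
  have h2 : ∑ l ∈ B, θ l ^ 2 ≤ (u * w) ^ 2 * V := by
    rw [hV, Finset.mul_sum]
    refine Finset.sum_le_sum fun l hl => ?_
    rw [hBdef, Finset.mem_Ico] at hl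
    have hl0 : (q : ℝ) * n ≤ l := by exact_mod_cast hl.1
    have hpos : 0 < (q : ℝ) * n := by positivity
    have h3 : (u * w) ^ 2 = ((q : ℝ) * n) ^ (-(2 * α)) := by
      rw [hu, hw, mul_comm, ← Real.mul_rpow hq0.le hn0.le, ← Real.rpow_natCast,
        ← Real.rpow_mul hpos.le]
      congr 1; push_cast; ring
    have h4 : ((q : ℝ) * n) ^ (2 * α) ≤ (l : ℝ) ^ (2 * α) :=
      Real.rpow_le_rpow hpos.le hl0 (by linarith)
    have h5 : 1 ≤ (u * w) ^ 2 * (l : ℝ) ^ (2 * α) := by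
      rw [h3, Real.rpow_neg hpos.le, inv_mul_eq_div,
        one_le_div (Real.rpow_pos_of_pos hpos _)]
      exact h4
    nlinarith [sq_nonneg (θ l)]
  rw [hw2]
  refine abs_le_of_sq_le_sq' ?_ (by positivity) |>.2
  refine h1.trans ?_
  have hsn : √(n : ℝ) ^ 2 = n := Real.sq_sqrt hn0.le
  calc 4 * (n : ℝ) * ∑ l ∈ B, θ l ^ 2 ≤ 4 * n * ((u * w) ^ 2 * V) := by gcongr
    _ = n * u ^ 2 * (4 * w ^ 2 * V) := by ring
    _ ≤ n * u ^ 2 * (w ^ 2 + V) ^ 2 := by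
        gcongr
        nlinarith [sq_nonneg (w ^ 2 - V)]
    _ = (√(n : ℝ) * u * (w ^ 2 + V)) ^ 2 := by rw [mul_pow, mul_pow, hsn]

theorem norm_sum_Ico_le (hα : 1 / 2 < α)
    (hs : Summable (fun l : ℕ => (l : ℝ) ^ (2 * α) * θ l ^ 2)) {n : ℕ} (hn : 2 ≤ n) (Q : ℕ) :
    ‖∑ l ∈ Finset.Ico n ((Q + 1) * n), θ l • designValues n (trigBasis l)‖
      ≤ √n * (n : ℝ) ^ (-α) * (∑' q : ℕ, (q : ℝ) ^ (-(2 * α))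
        + ∑' l : ℕ, (l : ℝ) ^ (2 * α) * θ l ^ 2) := by
  have hstep : ‖∑ l ∈ Finset.Ico n ((Q + 1) * n), θ l • designValues n (trigBasis l)‖
      ≤ √n * (n : ℝ) ^ (-α) * (∑ q ∈ Finset.Ico 1 (Q + 1), (q : ℝ) ^ (-(2 * α))
        + ∑ l ∈ Finset.Ico n ((Q + 1) * n), (l : ℝ) ^ (2 * α) * θ l ^ 2) := by
    induction Q with
    | zero => simp
    | succ Q ih =>
      have h1 : n ≤ (Q + 1) * n := Nat.le_mul_of_pos_left n (Nat.succ_pos Q)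
      have h2 : (Q + 1) * n ≤ (Q + 1 + 1) * n := Nat.mul_le_mul_right n (Nat.le_succ _)
      rw [← Finset.sum_Ico_consecutive _ h1 h2, ← Finset.sum_Ico_consecutive _ h1 h2,
        Finset.sum_Ico_succ_top (by omega)]
      refine (norm_add_le _ _).trans ((add_le_add ih
        (norm_sum_block_le (α := α) (by linarith) hn (Nat.succ_pos Q))).trans (le_of_eq ?_))
      ring
  refine hstep.trans ?_
  gcongr
  · exact (Real.summable_nat_rpow.2 (by linarith)).sum_le_tsum _ fun q _ => by positivity
  · exact hs.sum_le_tsum _ fun q _ => by positivity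

theorem designValues_partialSum (n N : ℕ) :
    designValues n (partialSum θ N)
      = ∑ l ∈ Finset.range N, θ l • designValues n (trigBasis l) := by
  ext i
  simp [designValues_apply, partialSum]

theorem norm_designValues_sub_partialSum_le (hα : 1 / 2 < α) (h0 : θ 0 = 0)
    (hs : Summable (fun l : ℕ => (l : ℝ) ^ (2 * α) * θ l ^ 2)) {n : ℕ} (hn : 2 ≤ n) :
    ‖designValues n (fourierSum θ) - designValues n (partialSum θ n)‖
      ≤ √n * (n : ℝ) ^ (-α) * (∑' q : ℕ, (q : ℝ) ^ (-(2 * α))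
        + ∑' l : ℕ, (l : ℝ) ^ (2 * α) * θ l ^ 2) := by
  have habs := summable_abs_coeff hα h0 hs
  have hsub : Tendsto (fun Q : ℕ => (Q + 1) * n) atTop atTop :=
    tendsto_atTop_mono (fun Q => (Nat.le_succ Q).trans (Nat.le_mul_of_pos_right _ (by omega)))
      tendsto_id
  have hlim : Tendsto (fun Q : ℕ => designValues n (partialSum θ ((Q + 1) * n))) atTop
      (𝓝 (designValues n (fourierSum θ))) := by
    refine ((PiLp.continuous_toLp 2 _).tendsto _).comp (tendsto_pi_nhds.2 fun i => ?_)
    exact (tendsto_partialSum habs _).comp hsub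
  refine le_of_tendsto (hlim.sub_const (designValues n (partialSum θ n))).norm
    (Eventually.of_forall fun Q => ?_)
  rw [designValues_partialSum, designValues_partialSum, Finset.range_eq_Ico,
    ← Finset.sum_Ico_consecutive _ (Nat.zero_le n) (Nat.le_mul_of_pos_left n (Nat.succ_pos Q)),
    Finset.range_eq_Ico, add_sub_cancel_left]
  exact norm_sum_Ico_le hα hs hn Q

/-- All indices are below `n`, so discrete orthogonality recovers the coefficients exactly:
truncation at `n` leaves no aliasing. -/
theorem norm_proj_partialSum_sq (h0 : θ 0 = 0) {n k : ℕ} (hk : k < n) :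
    ‖proj n k (designValues n (partialSum θ n))‖ ^ 2
      = n * ∑ j ∈ Finset.range (k + 1), θ j ^ 2 := by
  have hn : n ≠ 0 := by omega
  have hn' : (n : ℝ) ≠ 0 := by exact_mod_cast hn
  have hinner : ∀ j : Fin k, ⟪designValues n (trigBasis ((j : ℕ) + 1)),
      designValues n (partialSum θ n)⟫ = n * θ ((j : ℕ) + 1) := fun j => by
    rw [designValues_partialSum, inner_sum, Finset.sum_eq_single ((j : ℕ) + 1)]
    · rw [inner_smul_right, inner_designValues_trigBasis hn (by omega) (by omega) (by omega)
        (by omega), if_pos rfl, mul_comm]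
    · intro l hl hne
      rw [Finset.mem_range] at hl
      rcases Nat.eq_zero_or_pos l with rfl | hl0
      · simp [h0]
      · rw [inner_smul_right, inner_designValues_trigBasis hn (by omega) (by omega) (by omega) hl,
          if_neg hne.symm, mul_zero]
    · intro h
      exact absurd (Finset.mem_range.2 (by omega)) h
  have h := norm_proj_sq_eq_sum hn (orthogonalDesign hk) (designValues n (partialSum θ n))
  simp_rw [hinner, mul_pow] at h
  rw [Fin.sum_univ_eq_sum_range (fun j => (n : ℝ) ^ 2 * θ (j + 1) ^ 2), ← Finset.mul_sum] at h
  apply mul_left_cancel₀ hn'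
  rw [h, Finset.sum_range_succ', h0]
  ring

theorem sum_tail_le (hα : 0 ≤ α)
    (hs : Summable (fun l : ℕ => (l : ℝ) ^ (2 * α) * θ l ^ 2)) {S : ℝ}
    (hS : HasSum (fun l => θ l ^ 2) S) {k : ℕ} (hk : 1 ≤ k) :
    |∑ j ∈ Finset.range (k + 1), θ j ^ 2 - S|
      ≤ (k : ℝ) ^ (-(2 * α)) * ∑' l : ℕ, (l : ℝ) ^ (2 * α) * θ l ^ 2 := by
  have hk0 : (0 : ℝ) < k := by exact_mod_cast hk
  have h1 := hS.summable.sum_add_tsum_nat_add (k + 1)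
  rw [hS.tsum_eq] at h1
  have h2 : 0 ≤ ∑' l, θ (l + (k + 1)) ^ 2 := tsum_nonneg fun _ => sq_nonneg _
  rw [abs_sub_comm, ← h1, add_sub_cancel_left, abs_of_nonneg h2]
  have hs' := (summable_nat_add_iff (k + 1)).2 hs
  have h3 : ∑' l : ℕ, ((l + (k + 1) : ℕ) : ℝ) ^ (2 * α) * θ (l + (k + 1)) ^ 2
      ≤ ∑' l : ℕ, (l : ℝ) ^ (2 * α) * θ l ^ 2 := by
    rw [← hs.sum_add_tsum_nat_add (k + 1)]
    exact le_add_of_nonneg_left (Finset.sum_nonneg fun l _ => by positivity)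
  refine le_trans ?_ (mul_le_mul_of_nonneg_left h3 (by positivity))
  rw [← tsum_mul_left]
  refine ((summable_nat_add_iff (k + 1)).2 hS.summable).tsum_le_tsum (fun l => ?_)
    (hs'.mul_left _)
  have h4 : (k : ℝ) ^ (2 * α) ≤ ((l + (k + 1) : ℕ) : ℝ) ^ (2 * α) :=
    Real.rpow_le_rpow hk0.le (by exact_mod_cast (by omega : k ≤ l + (k + 1))) (by linarith)
  have h5 : 1 ≤ (k : ℝ) ^ (-(2 * α)) * ((l + (k + 1) : ℕ) : ℝ) ^ (2 * α) := by
    rw [Real.rpow_neg hk0.le, inv_mul_eq_div, one_le_div (Real.rpow_pos_of_pos hk0 _)]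
    exact h4
  rw [← mul_assoc]
  exact le_mul_of_one_le_left (sq_nonneg _) h5

end Aliasing

theorem designValues_congr {f g : ℝ → ℝ} (h : Set.EqOn f g (Set.Icc 0 1)) (n : ℕ) :
    designValues n f = designValues n g := by
  ext i
  refine h ⟨by positivity, ?_⟩
  have hn : (0 : ℝ) < n := by exact_mod_cast i.pos
  rw [div_le_one hn]
  exact_mod_cast i.2

/-- The squared norm of the projected mean, divided by `n`, approximates `∫ f²` up to the
approximation error of the sieve and the discretization error. -/
theorem exists_bias_bound {α L : ℝ} (hα : 1 / 2 < α) {f : ℝ → ℝ} (hf : f ∈ sobolevClass α L)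
    (hfc : ContinuousOn f (Set.Icc 0 1)) :
    ∃ C : ℝ, ∀ n k : ℕ, 1 ≤ k → k < n →
      |sqNormFunctional n (proj n k (designValues n f)) - ∫ x in (0 : ℝ)..1, f x ^ 2|
        ≤ C * ((n : ℝ) ^ (-α) + (k : ℝ) ^ (-(2 * α))) := by
  obtain ⟨θ, h0, hs, hlim⟩ := exists_coefficients hα hf
  have habs := summable_abs_coeff hα h0 hs
  have heq := eqOn_fourierSum habs hf.1.1 hfc hlim
  have hS := hasSum_coeff_sq h0 habs heq
  set S := ∫ x in (0 : ℝ)..1, f x ^ 2 with hSdef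
  set V := ∑' l : ℕ, (l : ℝ) ^ (2 * α) * θ l ^ 2 with hV
  set K := ∑' q : ℕ, (q : ℝ) ^ (-(2 * α)) + V with hK
  have hV0 : 0 ≤ V := tsum_nonneg fun l => by positivity
  have hK0 : 0 ≤ K := add_nonneg (tsum_nonneg fun l => by positivity) hV0
  refine ⟨K * (K + 2 * √S) + V, fun n k hk hkn => ?_⟩
  have hn0 : (0 : ℝ) < n := by exact_mod_cast (by omega : 0 < n)
  have hn1 : (1 : ℝ) ≤ n := by exact_mod_cast (by omega : 1 ≤ n)
  set p := ‖proj n k (designValues n f)‖ / √n with hp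
  set s := ‖proj n k (designValues n (partialSum θ n))‖ / √n with hsdef
  have hsq : (0 : ℝ) < √n := Real.sqrt_pos.2 hn0
  have hp2 : sqNormFunctional n (proj n k (designValues n f)) = p ^ 2 := by
    rw [sqNormFunctional, hp, div_pow, Real.sq_sqrt hn0.le]
  have hs2 : s ^ 2 = ∑ j ∈ Finset.range (k + 1), θ j ^ 2 := by
    rw [hsdef, div_pow, Real.sq_sqrt hn0.le, norm_proj_partialSum_sq h0 hkn]
    field_simp
  -- The projection is a contraction, so replacing `f` by its truncation at `n` costs at most the
  -- aliasing bound.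
  have hps : |p - s| ≤ (n : ℝ) ^ (-α) * K := by
    rw [hp, hsdef, ← sub_div, abs_div, abs_of_pos hsq, div_le_iff₀ hsq]
    refine (abs_norm_sub_norm_le _ _).trans ?_
    rw [designValues_congr heq, proj, proj, ← map_sub]
    refine (Submodule.norm_starProjection_apply_le _ _).trans ?_
    refine (norm_designValues_sub_partialSum_le hα h0 hs (by omega)).trans (le_of_eq ?_)
    rw [← hV, ← hK]
    ring
  have hsS : s ≤ √S := by
    refine Real.le_sqrt_of_sq_le ?_
    rw [hs2]
    exact sum_le_hasSum _ (fun _ _ => sq_nonneg _) hS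
  have hs0 : 0 ≤ s := by positivity
  have hp0 : 0 ≤ p := by positivity
  have htail := sum_tail_le (by linarith) hs hS hk
  rw [← hs2, ← hV] at htail
  set e := (n : ℝ) ^ (-α) with he
  have he0 : 0 < e := Real.rpow_pos_of_pos hn0 _
  have he1 : e ≤ 1 := Real.rpow_le_one_of_one_le_of_nonpos hn1 (by linarith)
  have hk0 : 0 ≤ (k : ℝ) ^ (-(2 * α)) := by positivity
  have hdiff : |p ^ 2 - s ^ 2| ≤ e * (K * (K + 2 * √S)) := by
    have h1 : p ^ 2 - s ^ 2 = (p - s) * (p + s) := by ring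
    -- `p + s ≤ 2 s + |p - s|`, with `s ≤ √S` and `e ≤ 1`.
    have h2 : p + s ≤ K + 2 * √S := by
      have := le_abs_self (p - s)
      nlinarith
    rw [h1, abs_mul, abs_of_nonneg (add_nonneg hp0 hs0)]
    calc |p - s| * (p + s) ≤ (e * K) * (K + 2 * √S) := by gcongr
      _ = _ := by ring
  rw [hp2]
  have h3 : |p ^ 2 - S| ≤ |p ^ 2 - s ^ 2| + |s ^ 2 - S| := abs_sub_le _ _ _
  have h4 : 0 ≤ K * (K + 2 * √S) := by positivity
  nlinarith [mul_nonneg h4 hk0, mul_nonneg hV0 he0.le]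

/-! ### Quantitative coupling of the quadratic functional with a standard Gaussian variable -/

theorem proj_proj (n k : ℕ) (y : EuclideanSpace ℝ (Fin n)) :
    proj n k (proj n k y) = proj n k y :=
  Submodule.starProjection_eq_self_iff.2 (Submodule.starProjection_apply_mem _ _)

theorem measurable_proj (n k : ℕ) : Measurable (proj n k) :=
  (sieve n k).starProjection.continuous.measurable

theorem measurable_sqNormFunctional (n : ℕ) : Measurable (sqNormFunctional n) := by
  unfold sqNormFunctional
  fun_prop

theorem inner_proj_of_proj_eq {n k : ℕ} {v : EuclideanSpace ℝ (Fin n)} (hv : proj n k v = v)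
    (ξ : EuclideanSpace ℝ (Fin n)) : ⟪v, proj n k ξ⟫ = ⟪v, ξ⟫ := by
  conv_rhs => rw [← hv]
  rw [proj, proj, Submodule.inner_starProjection_left_eq_right]

theorem integrable_norm_proj_sq (n k : ℕ) :
    Integrable (fun ξ => ‖proj n k ξ‖ ^ 2) (stdGaussian (EuclideanSpace ℝ (Fin n))) :=
  integrable_norm_starProjection_sq (sieve n k)

/-- Bounds the error of the linear coefficient using only `r²`, which will be `G(v)/T`, and `1 -
c²`; these are the quantities controlled later. It uses `c ≤ √c` and `r ≤ 1 + r²`. -/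
theorem abs_shrinkage_sub_one_le {c r : ℝ} (hc0 : 0 ≤ c) (hc1 : c ≤ 1) (hr : 0 ≤ r) :
    |c * √c * r - 1| ≤ |r ^ 2 - 1| + (1 - c ^ 2) * (1 + r ^ 2) := by
  have hs0 := Real.sqrt_nonneg c
  have hs1 : √c ≤ 1 := Real.sqrt_le_one.2 hc1
  have hss := Real.mul_self_sqrt hc0
  have hcs : c ≤ √c := by nlinarith
  have h1 : |r - 1| ≤ |r ^ 2 - 1| := by
    have : r ^ 2 - 1 = (r - 1) * (r + 1) := by ring
    rw [this, abs_mul, abs_of_nonneg (by linarith : 0 ≤ r + 1)]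
    nlinarith [abs_nonneg (r - 1)]
  have h2 : c * √c * r - 1 = (r - 1) - (1 - c * √c) * r := by ring
  have h3 : c * √c ≤ 1 := mul_le_one₀ hc1 hs0 hs1
  have h4 : (1 - c * √c) * r ≤ (1 - c ^ 2) * (1 + r ^ 2) := by
    apply mul_le_mul _ _ hr _ <;> nlinarith [sq_nonneg (r - 1)]
  rw [h2]
  refine (abs_sub _ _).trans ?_
  rw [abs_of_nonneg (mul_nonneg (by linarith : 0 ≤ 1 - c * √c) hr)]
  linarith

/-- The rescaled quadratic functional of `c v + σ √c Pξ`, centered at its value at `v`. -/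
noncomputable def scaledDeviation (n k : ℕ) (σ T c : ℝ) (v ξ : EuclideanSpace ℝ (Fin n)) : ℝ :=
  √(n : ℝ) * (sqNormFunctional n (c • v + (σ * √c) • proj n k ξ) - sqNormFunctional n v) /
    (2 * σ * √T)

theorem measurable_scaledDeviation (n k : ℕ) (σ T c : ℝ) (v : EuclideanSpace ℝ (Fin n)) :
    Measurable (scaledDeviation n k σ T c v) := by
  unfold scaledDeviation
  have h1 := measurable_proj n k
  have h2 := measurable_sqNormFunctional n
  fun_prop

/-- Bound for the `L¹` distance between `scaledDeviation` and a standard Gaussian variable. -/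
noncomputable def couplingBound (n k : ℕ) (σ T c e : ℝ) : ℝ :=
  (1 - c ^ 2) * (√n * √T / (2 * σ) + 2 + (√n * √T / (2 * σ) + 1) * e) + e
    + σ / (2 * √T) * (k / √n)

theorem abs_scaledDeviation_sub_le {n k : ℕ} (hn : n ≠ 0) {σ T c : ℝ} (hσ : 0 < σ) (hT : 0 < T)
    (hc0 : 0 ≤ c) (hc1 : c ≤ 1) {v u : EuclideanSpace ℝ (Fin n)} (hv : proj n k v = v)
    (hvu : v = ‖v‖ • u) (ξ : EuclideanSpace ℝ (Fin n)) :
    |scaledDeviation n k σ T c v ξ - ⟪u, ξ⟫|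
      ≤ (1 - c ^ 2) * (√n * √T / (2 * σ)) * (sqNormFunctional n v / T)
        + (|sqNormFunctional n v / T - 1| + (1 - c ^ 2) * (1 + sqNormFunctional n v / T))
          * |⟪u, ξ⟫| + σ / (2 * √T * √n) * ‖proj n k ξ‖ ^ 2 := by
  have hn0 : (0 : ℝ) < n := by exact_mod_cast Nat.pos_of_ne_zero hn
  -- Writing `n = N²` and `T = t²` turns the expansion into a rational identity.
  obtain ⟨N, hN, hNn⟩ : ∃ N : ℝ, 0 < N ∧ (n : ℝ) = N ^ 2 :=
    ⟨√n, Real.sqrt_pos.2 hn0, (Real.sq_sqrt hn0.le).symm⟩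
  obtain ⟨t, ht, htT⟩ : ∃ t : ℝ, 0 < t ∧ T = t ^ 2 :=
    ⟨√T, Real.sqrt_pos.2 hT, (Real.sq_sqrt hT.le).symm⟩
  have hsqrtc : √c ^ 2 = c := Real.sq_sqrt hc0
  have hvξ : ⟪v, ξ⟫ = ‖v‖ * ⟪u, ξ⟫ := by
    conv_lhs => rw [hvu]
    rw [inner_smul_left]
    simp
  have hexp : ‖c • v + (σ * √c) • proj n k ξ‖ ^ 2
      = c ^ 2 * ‖v‖ ^ 2 + 2 * (c * (σ * √c) * (‖v‖ * ⟪u, ξ⟫)) + σ ^ 2 * c * ‖proj n k ξ‖ ^ 2 := by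
    rw [norm_add_sq_real, inner_smul_left, inner_smul_right, inner_proj_of_proj_eq hv, hvξ,
      norm_smul, norm_smul, mul_pow, mul_pow, Real.norm_eq_abs, Real.norm_eq_abs, sq_abs, sq_abs,
      mul_pow, hsqrtc]
    simp only [conj_trivial]
    ring
  unfold scaledDeviation sqNormFunctional
  rw [hexp, hNn, htT, Real.sqrt_sq hN.le, Real.sqrt_sq ht.le]
  set r := ‖v‖ / (N * t) with hr
  have hr0 : 0 ≤ r := by positivity
  have hvr : ‖v‖ = r * (N * t) := by rw [hr]; field_simp
  have hρ : ‖v‖ ^ 2 / N ^ 2 / t ^ 2 = r ^ 2 := by rw [hr]; field_simp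
  rw [hρ]
  have heq : N * ((c ^ 2 * ‖v‖ ^ 2 + 2 * (c * (σ * √c) * (‖v‖ * ⟪u, ξ⟫))
      + σ ^ 2 * c * ‖proj n k ξ‖ ^ 2) / N ^ 2 - ‖v‖ ^ 2 / N ^ 2) / (2 * σ * t) - ⟪u, ξ⟫
      = -((1 - c ^ 2) * (N * t / (2 * σ)) * r ^ 2) + (c * √c * r - 1) * ⟪u, ξ⟫
        + c * (σ / (2 * t * N) * ‖proj n k ξ‖ ^ 2) := by
    rw [hvr]
    field_simp
    ring
  rw [heq]
  have hc2 : 0 ≤ 1 - c ^ 2 := by nlinarith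
  refine (abs_add_three _ _ _).trans ?_
  rw [abs_neg, abs_mul (c * √c * r - 1)]
  refine add_le_add (add_le_add ?_ ?_) ?_
  · rw [abs_of_nonneg (by positivity)]
  · exact mul_le_mul_of_nonneg_right (abs_shrinkage_sub_one_le hc0 hc1 hr0) (abs_nonneg _)
  · rw [abs_of_nonneg (by positivity)]
    exact mul_le_of_le_one_left (by positivity) hc1

theorem integral_abs_scaledDeviation_sub_le {n k : ℕ} (hn : n ≠ 0) {σ T c : ℝ} (hσ : 0 < σ)
    (hT : 0 < T) (hc0 : 0 ≤ c) (hc1 : c ≤ 1) {v u : EuclideanSpace ℝ (Fin n)}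
    (hv : proj n k v = v) (hu : ‖u‖ = 1) (hvu : v = ‖v‖ • u) :
    Integrable (fun ξ => |scaledDeviation n k σ T c v ξ - ⟪u, ξ⟫|)
        (stdGaussian (EuclideanSpace ℝ (Fin n))) ∧
      ∫ ξ, |scaledDeviation n k σ T c v ξ - ⟪u, ξ⟫| ∂(stdGaussian (EuclideanSpace ℝ (Fin n)))
        ≤ couplingBound n k σ T c |sqNormFunctional n v / T - 1| := by
  have hn0 : (0 : ℝ) < n := by exact_mod_cast Nat.pos_of_ne_zero hn
  have hN : 0 < √(n : ℝ) := Real.sqrt_pos.2 hn0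
  have ht : 0 < √T := Real.sqrt_pos.2 hT
  have hpt := abs_scaledDeviation_sub_le hn hσ hT hc0 hc1 hv hvu
  set ρ := sqNormFunctional n v / T with hρdef
  have hρ0 : 0 ≤ ρ := by rw [hρdef, sqNormFunctional]; positivity
  have hc2 : 0 ≤ 1 - c ^ 2 := by nlinarith
  set A := (1 - c ^ 2) * (√n * √T / (2 * σ)) * ρ with hA
  set D := |ρ - 1| + (1 - c ^ 2) * (1 + ρ) with hD
  set R := σ / (2 * √T * √n) with hR
  have hD0 : 0 ≤ D := by positivity
  have hR0 : 0 ≤ R := by positivity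
  have i1 := (integrable_abs_inner_stdGaussian u).const_mul D
  have i2 := (integrable_norm_proj_sq n k).const_mul R
  have i3 : Integrable (fun ξ => A + D * |⟪u, ξ⟫|) (stdGaussian (EuclideanSpace ℝ (Fin n))) :=
    (integrable_const A).add i1
  have hdom : Integrable (fun ξ => A + D * |⟪u, ξ⟫| + R * ‖proj n k ξ‖ ^ 2)
      (stdGaussian (EuclideanSpace ℝ (Fin n))) := i3.add i2
  have hint : Integrable (fun ξ => |scaledDeviation n k σ T c v ξ - ⟪u, ξ⟫|)
      (stdGaussian (EuclideanSpace ℝ (Fin n))) := by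
    refine hdom.mono' ?_ (ae_of_all _ fun ξ => ?_)
    · have := measurable_scaledDeviation n k σ T c v
      exact Measurable.aestronglyMeasurable (by fun_prop)
    · rw [Real.norm_eq_abs, abs_abs]
      exact hpt ξ
  refine ⟨hint, (integral_mono hint hdom hpt).trans ?_⟩
  rw [integral_add i3 i2, integral_add (integrable_const A) i1,
    integral_const_mul D, integral_const_mul R]
  simp only [integral_const, probReal_univ, one_smul]
  have h1 := mul_le_mul_of_nonneg_left (integral_abs_inner_stdGaussian_le hu) hD0
  have h2 := mul_le_mul_of_nonneg_left (integral_norm_proj_sq_le n k) hR0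
  have h3 : R * k = σ / (2 * √T) * (k / √n) := by rw [hR]; field_simp
  have hρ1 : ρ ≤ 1 + |ρ - 1| := by linarith [le_abs_self (ρ - 1)]
  have h4 : A ≤ (1 - c ^ 2) * (√n * √T / (2 * σ)) * (1 + |ρ - 1|) :=
    mul_le_mul_of_nonneg_left hρ1 (by positivity)
  have h5 : (1 - c ^ 2) * (1 + ρ) ≤ (1 - c ^ 2) * (2 + |ρ - 1|) :=
    mul_le_mul_of_nonneg_left (by linarith) hc2
  unfold couplingBound
  rw [← h3]
  linarith

theorem integral_abs_inner_le {n : ℕ} (v : EuclideanSpace ℝ (Fin n)) :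
    ∫ ξ, |⟪v, ξ⟫| ∂(stdGaussian (EuclideanSpace ℝ (Fin n))) ≤ ‖v‖ := by
  by_cases hv : v = 0
  · simp [hv]
  have hv0 : ‖v‖ ≠ 0 := norm_ne_zero_iff.2 hv
  have : Nontrivial (EuclideanSpace ℝ (Fin n)) := ⟨v, 0, hv⟩
  obtain ⟨u, hu, hvu⟩ := exists_unit_vector_smul v
  have h : ∀ ξ, |⟪v, ξ⟫| = ‖v‖ * |⟪u, ξ⟫| := fun ξ => by
    conv_lhs => rw [hvu]
    rw [inner_smul_left, abs_mul]
    simp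
  simp_rw [h]
  rw [integral_const_mul]
  exact mul_le_of_le_one_right (norm_nonneg _) (integral_abs_inner_stdGaussian_le hu)

/-- Bound for the mean absolute error of `G(PY) / T` around `1`. -/
theorem integral_abs_sqNormFunctional_proj_le {n k : ℕ} (hn : n ≠ 0) {σ T : ℝ} (hσ : 0 < σ)
    (hT : 0 < T) (F : EuclideanSpace ℝ (Fin n)) :
    Integrable (fun y => |sqNormFunctional n (proj n k y) / T - 1|) (sampling n σ F) ∧
      ∫ y, |sqNormFunctional n (proj n k y) / T - 1| ∂(sampling n σ F)
        ≤ |sqNormFunctional n (proj n k F) / T - 1|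
          + (2 * σ * ‖proj n k F‖ + σ ^ 2 * k) / (n * T) := by
  have hn0 : (0 : ℝ) < n := by exact_mod_cast Nat.pos_of_ne_zero hn
  have hmeas : Measurable fun y => |sqNormFunctional n (proj n k y) / T - 1| := by
    have h1 := measurable_proj n k
    have h2 := measurable_sqNormFunctional n
    fun_prop
  have hm : Measurable fun ξ : EuclideanSpace ℝ (Fin n) => F + σ • ξ := by fun_prop
  rw [sampling_eq n hσ.le, integrable_map_measure hmeas.aestronglyMeasurable hm.aemeasurable,
    integral_map hm.aemeasurable hmeas.aestronglyMeasurable]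
  have hpt : ∀ ξ, |sqNormFunctional n (proj n k (F + σ • ξ)) / T - 1|
      ≤ |sqNormFunctional n (proj n k F) / T - 1|
        + (2 * σ / (n * T) * |⟪proj n k F, ξ⟫| + σ ^ 2 / (n * T) * ‖proj n k ξ‖ ^ 2) := fun ξ => by
    have hexp : sqNormFunctional n (proj n k (F + σ • ξ)) / T - 1
        = (sqNormFunctional n (proj n k F) / T - 1)
          + (2 * σ / (n * T) * ⟪proj n k F, ξ⟫ + σ ^ 2 / (n * T) * ‖proj n k ξ‖ ^ 2) := by
      have h1 : proj n k (F + σ • ξ) = proj n k F + σ • proj n k ξ := by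
        simp only [proj, map_add, map_smul]
      rw [h1, sqNormFunctional, sqNormFunctional, norm_add_sq_real, inner_smul_right,
        inner_proj_of_proj_eq (proj_proj n k F), norm_smul, mul_pow, Real.norm_eq_abs, sq_abs]
      field_simp
      ring
    rw [hexp]
    refine (abs_add_le _ _).trans (add_le_add le_rfl ((abs_add_le _ _).trans ?_))
    rw [abs_mul, abs_of_nonneg (by positivity : 0 ≤ 2 * σ / (n * T)),
      abs_of_nonneg (by positivity : 0 ≤ σ ^ 2 / (n * T) * ‖proj n k ξ‖ ^ 2)]
  have i1 := (integrable_abs_inner_stdGaussian (proj n k F)).const_mul (2 * σ / (n * T))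
  have i2 := (integrable_norm_proj_sq n k).const_mul (σ ^ 2 / (n * T))
  have i3 : Integrable (fun ξ => 2 * σ / (n * T) * |⟪proj n k F, ξ⟫|
      + σ ^ 2 / (n * T) * ‖proj n k ξ‖ ^ 2) (stdGaussian (EuclideanSpace ℝ (Fin n))) := i1.add i2
  have hdom : Integrable (fun ξ => |sqNormFunctional n (proj n k F) / T - 1|
      + (2 * σ / (n * T) * |⟪proj n k F, ξ⟫| + σ ^ 2 / (n * T) * ‖proj n k ξ‖ ^ 2))
      (stdGaussian (EuclideanSpace ℝ (Fin n))) := (integrable_const _).add i3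
  have hint : Integrable (fun ξ => |sqNormFunctional n (proj n k (F + σ • ξ)) / T - 1|)
      (stdGaussian (EuclideanSpace ℝ (Fin n))) := by
    refine hdom.mono' (hmeas.comp hm).aestronglyMeasurable (ae_of_all _ fun ξ => ?_)
    rw [Real.norm_eq_abs, abs_abs]
    exact hpt ξ
  refine ⟨hint, (integral_mono hint hdom hpt).trans ?_⟩
  rw [integral_add (integrable_const _) i3, integral_add i1 i2, integral_const_mul,
    integral_const_mul]
  simp only [integral_const, probReal_univ, one_smul]
  have h1 := mul_le_mul_of_nonneg_left (integral_abs_inner_le (proj n k F))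
    (by positivity : 0 ≤ 2 * σ / (n * T))
  have h2 := mul_le_mul_of_nonneg_left (integral_norm_proj_sq_le n k)
    (by positivity : 0 ≤ σ ^ 2 / (n * T))
  have h3 : (2 * σ * ‖proj n k F‖ + σ ^ 2 * k) / (n * T)
      = 2 * σ / (n * T) * ‖proj n k F‖ + σ ^ 2 / (n * T) * k := by ring
  rw [h3]
  linarith

/-! ### The posterior and the plug-in estimator for a fixed sample size -/

theorem nontrivial_euclideanSpace {n : ℕ} (hn : n ≠ 0) :
    Nontrivial (EuclideanSpace ℝ (Fin n)) := by
  have : NeZero n := ⟨hn⟩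
  infer_instance

theorem intervalDist_posterior_le {n k : ℕ} (hk : k < n) {σ T γ : ℝ} (hσ : 0 < σ)
    (hT : 0 < T) (hγ : 0 < γ) (F : EuclideanSpace ℝ (Fin n)) {δ : ℝ} (hδ : 0 < δ) :
    ∀ᵐ y ∂(sampling n σ F),
      intervalDist ((posteriorDist n k σ γ y).map fun F =>
          √(n : ℝ) * (sqNormFunctional n F - sqNormFunctional n (proj n k y)) / (2 * σ * √T))
        (gaussianReal 0 1)
      ≤ ENNReal.ofReal (couplingBound n k σ T (γ * n / (γ * n + σ ^ 2))
          |sqNormFunctional n (proj n k y) / T - 1| / δ + 2 * δ) := by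
  have hn : n ≠ 0 := by omega
  have hn0 : (0 : ℝ) < n := by exact_mod_cast Nat.pos_of_ne_zero hn
  have := nontrivial_euclideanSpace hn
  filter_upwards [posteriorDist_eq hn (orthogonalDesign hk) hσ hγ F] with y hy
  set c := γ * n / (γ * n + σ ^ 2) with hc
  have hc0 : 0 ≤ c := by positivity
  have hc1 : c ≤ 1 := by
    rw [hc, div_le_one (by positivity)]
    nlinarith [sq_nonneg σ]
  obtain ⟨u, hu, hvu⟩ := exists_unit_vector_smul (proj n k y)
  obtain ⟨hint, hle⟩ := integral_abs_scaledDeviation_sub_le hn hσ hT hc0 hc1 (proj_proj n k y)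
    hu hvu
  have hm1 := measurable_proj n k
  have hm2 := measurable_sqNormFunctional n
  rw [hy, Measure.map_map (by fun_prop) (by fun_prop)]
  refine (intervalDist_le_of_coupling (measurable_scaledDeviation n k σ T c (proj n k y))
    (by fun_prop) (map_inner_stdGaussian hu) hint hδ).trans (ENNReal.ofReal_le_ofReal ?_)
  gcongr

theorem lintegral_intervalDist_posterior_le {n k : ℕ} (hk : k < n) {σ T γ : ℝ} (hσ : 0 < σ)
    (hT : 0 < T) (hγ : 0 < γ) (F : EuclideanSpace ℝ (Fin n)) {δ : ℝ} (hδ : 0 < δ) :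
    ∫⁻ y, intervalDist ((posteriorDist n k σ γ y).map fun F =>
          √(n : ℝ) * (sqNormFunctional n F - sqNormFunctional n (proj n k y)) / (2 * σ * √T))
        (gaussianReal 0 1) ∂(sampling n σ F)
      ≤ ENNReal.ofReal (couplingBound n k σ T (γ * n / (γ * n + σ ^ 2))
          (∫ y, |sqNormFunctional n (proj n k y) / T - 1| ∂(sampling n σ F)) / δ + 2 * δ) := by
  have hn : n ≠ 0 := by omega
  have hn0 : (0 : ℝ) < n := by exact_mod_cast Nat.pos_of_ne_zero hn
  obtain ⟨hint, _⟩ := integral_abs_sqNormFunctional_proj_le (k := k) hn hσ hT F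
  refine (lintegral_mono_ae (intervalDist_posterior_le hk hσ hT hγ F hδ)).trans ?_
  set c := γ * n / (γ * n + σ ^ 2) with hc
  have hc0 : 0 ≤ c := by positivity
  have hc1 : c ≤ 1 := by
    rw [hc, div_le_one (by positivity)]
    nlinarith [sq_nonneg σ]
  have hc2 : 0 ≤ 1 - c ^ 2 := by nlinarith
  -- The bound is affine in `e`, so integrating over `y` just replaces the random error by its mean.
  obtain ⟨p, q, hp, hq, hpq⟩ : ∃ p q : ℝ, 0 ≤ p ∧ 0 ≤ q ∧
      ∀ e, couplingBound n k σ T c e / δ + 2 * δ = p + q * e := by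
    refine ⟨((1 - c ^ 2) * (√n * √T / (2 * σ) + 2) + σ / (2 * √T) * (k / √n)) / δ + 2 * δ,
      ((1 - c ^ 2) * (√n * √T / (2 * σ) + 1) + 1) / δ, by positivity, by positivity, fun e => ?_⟩
    unfold couplingBound
    ring
  simp_rw [hpq]
  have i1 : Integrable (fun y => p + q * |sqNormFunctional n (proj n k y) / T - 1|)
      (sampling n σ F) := (integrable_const p).add (hint.const_mul q)
  rw [← ofReal_integral_eq_lintegral_ofReal i1
    (ae_of_all _ fun y => by positivity), integral_add (integrable_const p) (hint.const_mul q),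
    integral_const_mul]
  simp

/-- With `Y = F + σ ξ`, the estimator's deviation is `scaledDeviation` without shrinkage, based at
`v = P F`; the Gaussian variable is the standardized noise along `P F`. -/
theorem exists_coupling_plugin {n : ℕ} (hn : n ≠ 0) (k : ℕ) {σ T : ℝ} (hσ : 0 < σ) (hT : 0 < T)
    (F : EuclideanSpace ℝ (Fin n)) :
    ∃ Z : EuclideanSpace ℝ (Fin n) → ℝ, Measurable Z ∧
      (sampling n σ F).map Z = gaussianReal 0 1 ∧
      Integrable (fun y => |√(n : ℝ) * (sqNormFunctional n (proj n k y) -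
        sqNormFunctional n (proj n k F)) / (2 * σ * √T) - Z y|) (sampling n σ F) ∧
      ∫ y, |√(n : ℝ) * (sqNormFunctional n (proj n k y) -
        sqNormFunctional n (proj n k F)) / (2 * σ * √T) - Z y| ∂(sampling n σ F)
        ≤ couplingBound n k σ T 1 |sqNormFunctional n (proj n k F) / T - 1| := by
  have := nontrivial_euclideanSpace hn
  obtain ⟨u, hu, hvu⟩ := exists_unit_vector_smul (proj n k F)
  have hm1 := measurable_proj n k
  have hm2 := measurable_sqNormFunctional n
  have hm : Measurable fun ξ : EuclideanSpace ℝ (Fin n) => F + σ • ξ := by fun_prop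
  have hZ : Measurable fun y : EuclideanSpace ℝ (Fin n) => ⟪u, σ⁻¹ • (y - F)⟫ := by fun_prop
  have hZξ : ∀ ξ : EuclideanSpace ℝ (Fin n), ⟪u, σ⁻¹ • (F + σ • ξ - F)⟫ = ⟪u, ξ⟫ := fun ξ => by
    rw [add_sub_cancel_left, smul_smul, inv_mul_cancel₀ hσ.ne', one_smul]
  obtain ⟨hint, hle⟩ := integral_abs_scaledDeviation_sub_le hn hσ hT zero_le_one le_rfl
    (proj_proj n k F) hu hvu
  have hX : ∀ ξ, √(n : ℝ) * (sqNormFunctional n (proj n k (F + σ • ξ)) -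
        sqNormFunctional n (proj n k F)) / (2 * σ * √T)
      = scaledDeviation n k σ T 1 (proj n k F) ξ := fun ξ => by
    simp [scaledDeviation, proj]
  have hmeas : Measurable fun y => |√(n : ℝ) * (sqNormFunctional n (proj n k y) -
        sqNormFunctional n (proj n k F)) / (2 * σ * √T) - ⟪u, σ⁻¹ • (y - F)⟫| := by fun_prop
  refine ⟨_, hZ, ?_, ?_, ?_⟩
  · rw [sampling_eq n hσ.le, Measure.map_map hZ hm, ← map_inner_stdGaussian hu]
    congr 1
    ext1 ξ
    exact hZξ ξ
  · rw [sampling_eq n hσ.le, integrable_map_measure hmeas.aestronglyMeasurable hm.aemeasurable]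
    refine hint.congr (ae_of_all _ fun ξ => ?_)
    simp only [Function.comp_apply, hX, hZξ]
  · rw [sampling_eq n hσ.le, integral_map hm.aemeasurable hmeas.aestronglyMeasurable]
    simp only [hX, hZξ]
    exact hle

/-! ### Admissible cutoffs -/

theorem tendsto_sqrt_natCast : Tendsto (fun n : ℕ => √(n : ℝ)) atTop atTop :=
  Real.tendsto_sqrt_atTop.comp tendsto_natCast_atTop_atTop

theorem AdmissibleCutoff.tendsto_div_sqrt {α : ℝ} {k : ℕ → ℕ} (h : AdmissibleCutoff α k) :
    Tendsto (fun n => (k n : ℝ) / √(n : ℝ)) atTop (𝓝 0) :=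
  h.1.tendsto_div_nhds_zero

theorem AdmissibleCutoff.tendsto_sqrt_mul {α : ℝ} {k : ℕ → ℕ} (h : AdmissibleCutoff α k) :
    Tendsto (fun n : ℕ => √(n : ℝ) * (k n : ℝ) ^ (-(2 * α))) atTop (𝓝 0) := by
  refine h.2.tendsto_div_nhds_zero.congr fun n => ?_
  rw [Real.rpow_neg (Nat.cast_nonneg _), div_eq_mul_inv]

theorem AdmissibleCutoff.eventually_bounds {α : ℝ} (hα : 0 < α) {k : ℕ → ℕ}
    (h : AdmissibleCutoff α k) : ∀ᶠ n in atTop, 1 ≤ k n ∧ k n < n := by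
  filter_upwards [h.1.bound (by norm_num : (0 : ℝ) < 1 / 2), h.2.bound one_pos,
    eventually_ge_atTop 1] with n h1 h2 hn
  have hn1 : (1 : ℝ) ≤ n := by exact_mod_cast hn
  have hsq : 1 ≤ √(n : ℝ) := Real.one_le_sqrt.2 hn1
  have hss : √(n : ℝ) * √(n : ℝ) = n := Real.mul_self_sqrt (by linarith)
  constructor
  -- If `k n = 0`, then `(k n)^(2α) = 0` cannot dominate `√n ≥ 1`. The upper bound below follows
  -- from `k n ≤ √n / 2`.
  · by_contra hk
    have hk0 : k n = 0 := by omega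
    rw [hk0, Nat.cast_zero, Real.zero_rpow (by linarith), norm_zero, mul_zero,
      Real.norm_of_nonneg (Real.sqrt_nonneg _)] at h2
    linarith
  · rw [Real.norm_of_nonneg (Nat.cast_nonneg _), Real.norm_of_nonneg (Real.sqrt_nonneg _)] at h1
    have : (k n : ℝ) < n := by nlinarith
    exact_mod_cast this

theorem admissibleCutoff_floor {β : ℝ} (hβ : 1 / 2 < β) :
    AdmissibleCutoff β (fun n : ℕ => ⌊√(n : ℝ) / Real.log (n : ℝ)⌋₊) := by
  have hlog : Tendsto (fun n : ℕ => Real.log (n : ℝ)) atTop atTop :=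
    Real.tendsto_log_atTop.comp tendsto_natCast_atTop_atTop
  constructor
  · refine isLittleO_of_tendsto' ?_ ?_
    · filter_upwards [eventually_ge_atTop 1] with n hn h0
      have hn1 : (1 : ℝ) ≤ n := by exact_mod_cast hn
      have := Real.one_le_sqrt.2 hn1
      linarith
    · refine squeeze_zero' (Eventually.of_forall fun n => by positivity) ?_
        (tendsto_inv_atTop_zero.comp hlog)
      filter_upwards [eventually_ge_atTop 2] with n hn
      have hn1 : (2 : ℝ) ≤ n := by exact_mod_cast hn
      have hs : 0 < √(n : ℝ) := Real.sqrt_pos.2 (by linarith)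
      have hl : 0 < Real.log (n : ℝ) := Real.log_pos (by linarith)
      rw [div_le_iff₀ hs]
      refine (Nat.floor_le (by positivity)).trans (le_of_eq ?_)
      simp only [Function.comp_apply]
      rw [div_eq_inv_mul]
  -- Since `log n` is below `n^ε`, the cutoff is at least `n^(1/2 - ε)`. This `ε` makes `(1/2 - ε)
  -- 2β = 1/2 + (β - 1/2)/2`, half of the excess over `1/2`.
  · set ε := (β - 1 / 2) / (4 * β) with hε
    have hε0 : 0 < ε := div_pos (by linarith) (by linarith)
    have hε1 : ε < 1 / 4 := by rw [hε, div_lt_iff₀ (by linarith)]; linarith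
    have hbound := ((isLittleO_log_rpow_atTop hε0).comp_tendsto
      (tendsto_natCast_atTop_atTop (R := ℝ))).bound (by norm_num : (0 : ℝ) < 1 / 2)
    refine isLittleO_of_tendsto' ?_ ?_
    · filter_upwards [hbound, eventually_ge_atTop 16] with n h1 hn h0
      exfalso
      have hn1 : (16 : ℝ) ≤ n := by exact_mod_cast hn
      have hl : 0 < Real.log (n : ℝ) := Real.log_pos (by linarith)
      rw [Real.rpow_eq_zero (Nat.cast_nonneg _) (by linarith), Nat.cast_eq_zero,
        Nat.floor_eq_zero, div_lt_one hl] at h0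
      simp only [Function.comp_apply] at h1
      rw [Real.norm_of_nonneg hl.le, Real.norm_of_nonneg (by positivity)] at h1
      have h2 : (n : ℝ) ^ ε ≤ √n := by
        rw [Real.sqrt_eq_rpow]
        exact Real.rpow_le_rpow_of_exponent_le (by linarith) (by linarith)
      linarith [Real.sqrt_nonneg (n : ℝ)]
    · have hlim : Tendsto (fun n : ℕ => (n : ℝ) ^ (-((β - 1 / 2) / 2))) atTop (𝓝 0) :=
        (tendsto_rpow_neg_atTop (by linarith)).comp tendsto_natCast_atTop_atTop
      refine squeeze_zero' (Eventually.of_forall fun n => by positivity) ?_ hlim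
      filter_upwards [hbound, eventually_ge_atTop 16] with n h1 hn
      have hn1 : (16 : ℝ) ≤ n := by exact_mod_cast hn
      have hn0 : (0 : ℝ) < n := by linarith
      have hl : 0 < Real.log (n : ℝ) := Real.log_pos (by linarith)
      simp only [Function.comp_apply] at h1
      rw [Real.norm_of_nonneg hl.le, Real.norm_of_nonneg (by positivity)] at h1
      set r := √(n : ℝ) / Real.log (n : ℝ) with hr
      have hpow : 0 < (n : ℝ) ^ ε := Real.rpow_pos_of_pos hn0 _
      -- The spare factor 2, from `log n ≤ n^ε / 2`, absorbs the loss of at most 1 in the floor.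
      have h3 : 2 * (n : ℝ) ^ (1 / 2 - ε) ≤ r := by
        rw [hr, le_div_iff₀ hl, Real.sqrt_eq_rpow]
        have h4 : (n : ℝ) ^ (1 / 2 - ε) * (n : ℝ) ^ ε = (n : ℝ) ^ (1 / 2 : ℝ) := by
          rw [← Real.rpow_add hn0]; congr 1; ring
        have h5 : 0 < (n : ℝ) ^ (1 / 2 - ε) := Real.rpow_pos_of_pos hn0 _
        nlinarith
      have h6 : 1 ≤ (n : ℝ) ^ (1 / 2 - ε) :=
        Real.one_le_rpow (by linarith) (by linarith)
      have h7 : (n : ℝ) ^ (1 / 2 - ε) ≤ (⌊r⌋₊ : ℝ) := by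
        have := Nat.lt_floor_add_one r
        linarith
      have h8 : ((n : ℝ) ^ (1 / 2 - ε)) ^ (2 * β) ≤ (⌊r⌋₊ : ℝ) ^ (2 * β) :=
        Real.rpow_le_rpow (by positivity) h7 (by linarith)
      rw [← Real.rpow_mul hn0.le] at h8
      have h9 : 0 < (n : ℝ) ^ ((1 / 2 - ε) * (2 * β)) := Real.rpow_pos_of_pos hn0 _
      rw [div_le_iff₀ (h9.trans_le h8)]
      calc √(n : ℝ) = (n : ℝ) ^ (-((β - 1 / 2) / 2)) * (n : ℝ) ^ ((1 / 2 - ε) * (2 * β)) := by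
            rw [Real.sqrt_eq_rpow, ← Real.rpow_add hn0]
            congr 1
            rw [hε]
            have : β ≠ 0 := by linarith
            field_simp
            ring
        _ ≤ _ := mul_le_mul_of_nonneg_left h8 (by positivity)

theorem exists_admissibleCutoff {α : ℝ} (hα : 1 / 2 < α) :
    ∃ k : ℕ → ℕ, (∀ n, 1 ≤ n → 1 ≤ k n ∧ k n ≤ n) ∧ AdmissibleCutoff α k := by
  have h := admissibleCutoff_floor hα
  -- Clamping enforces the bounds for every `n ≥ 1` and changes only finitely many values.
  refine ⟨fun n => max 1 (min n ⌊√(n : ℝ) / Real.log (n : ℝ)⌋₊), fun n hn => ⟨le_max_left _ _, max_le hn (min_le_left _ _)⟩, ?_⟩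
  have heq : (fun n : ℕ => ⌊√(n : ℝ) / Real.log (n : ℝ)⌋₊) =ᶠ[atTop]
      fun n : ℕ => max 1 (min n ⌊√(n : ℝ) / Real.log (n : ℝ)⌋₊) := by
    filter_upwards [h.eventually_bounds (by linarith)] with n hn
    omega
  exact ⟨h.1.congr' (heq.mono fun n hn => congrArg (fun m : ℕ => (m : ℝ)) hn) EventuallyEq.rfl,
    h.2.congr' EventuallyEq.rfl (heq.mono fun n hn => congrArg (fun m : ℕ => (m : ℝ) ^ (2 * α)) hn)⟩

/-! ### Asymptotics -/

theorem tendsto_bias {α L : ℝ} (hα : 1 / 2 < α) {f : ℝ → ℝ} (hf : f ∈ sobolevClass α L)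
    (hfc : ContinuousOn f (Set.Icc 0 1)) {k : ℕ → ℕ} (hk : AdmissibleCutoff α k) :
    Tendsto (fun n : ℕ => √(n : ℝ) * (sqNormFunctional n (proj n (k n) (designValues n f)) -
      ∫ x in (0 : ℝ)..1, f x ^ 2)) atTop (𝓝 0) := by
  obtain ⟨C, hC⟩ := exists_bias_bound hα hf hfc
  have h1 : Tendsto (fun n : ℕ => √(n : ℝ) * (n : ℝ) ^ (-α)) atTop (𝓝 0) := by
    have h2 : Tendsto (fun n : ℕ => (n : ℝ) ^ (-(α - 1 / 2))) atTop (𝓝 0) :=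
      (tendsto_rpow_neg_atTop (by linarith)).comp tendsto_natCast_atTop_atTop
    refine h2.congr' ?_
    filter_upwards [eventually_ge_atTop 1] with n hn
    have hn0 : (0 : ℝ) < n := by exact_mod_cast hn
    rw [Real.sqrt_eq_rpow, ← Real.rpow_add hn0]
    congr 1
    ring
  have h2 := (h1.add hk.tendsto_sqrt_mul).const_mul C
  rw [add_zero, mul_zero] at h2
  refine squeeze_zero_norm' ?_ h2
  filter_upwards [hk.eventually_bounds (by linarith)] with n hn
  rw [norm_mul, Real.norm_of_nonneg (Real.sqrt_nonneg _), Real.norm_eq_abs]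
  calc √(n : ℝ) * |sqNormFunctional n (proj n (k n) (designValues n f)) -
        ∫ x in (0 : ℝ)..1, f x ^ 2|
      ≤ √(n : ℝ) * (C * ((n : ℝ) ^ (-α) + (k n : ℝ) ^ (-(2 * α)))) :=
        mul_le_mul_of_nonneg_left (hC n (k n) hn.1 hn.2) (Real.sqrt_nonneg _)
    _ = _ := by ring

theorem tendsto_sqNormFunctional {α L : ℝ} (hα : 1 / 2 < α) {f : ℝ → ℝ}
    (hf : f ∈ sobolevClass α L) (hfc : ContinuousOn f (Set.Icc 0 1)) {k : ℕ → ℕ}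
    (hk : AdmissibleCutoff α k) :
    Tendsto (fun n : ℕ => sqNormFunctional n (proj n (k n) (designValues n f))) atTop
      (𝓝 (∫ x in (0 : ℝ)..1, f x ^ 2)) := by
  have hbias := (tendsto_bias hα hf hfc hk).norm
  rw [norm_zero] at hbias
  rw [tendsto_iff_norm_sub_tendsto_zero]
  refine squeeze_zero' (Eventually.of_forall fun _ => norm_nonneg _) ?_ hbias
  filter_upwards [eventually_ge_atTop 1] with n hn
  have hn1 : (1 : ℝ) ≤ n := by exact_mod_cast hn
  rw [norm_mul, Real.norm_of_nonneg (Real.sqrt_nonneg _)]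
  exact le_mul_of_one_le_left (norm_nonneg _) (Real.one_le_sqrt.2 hn1)

/-- The mean absolute error of `G(PY) / T` around `1` tends to zero. -/
theorem tendsto_integral_abs_ratio_sub_one {σ T : ℝ} (hσ : 0 < σ) (hT : 0 < T) {k : ℕ → ℕ}
    {F : (n : ℕ) → EuclideanSpace ℝ (Fin n)}
    (hk : Tendsto (fun n => (k n : ℝ) / √(n : ℝ)) atTop (𝓝 0))
    (hF : Tendsto (fun n => sqNormFunctional n (proj n (k n) (F n))) atTop (𝓝 T)) :
    Tendsto (fun n => ∫ y, |sqNormFunctional n (proj n (k n) y) / T - 1| ∂(sampling n σ (F n)))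
      atTop (𝓝 0) := by
  have hinv : Tendsto (fun n : ℕ => (√(n : ℝ))⁻¹) atTop (𝓝 0) :=
    tendsto_inv_atTop_zero.comp tendsto_sqrt_natCast
  have h1 : Tendsto (fun n => |sqNormFunctional n (proj n (k n) (F n)) / T - 1|) atTop (𝓝 0) := by
    have := ((hF.div_const T).sub_const 1).abs
    simpa [hT.ne'] using this
  have h2 : Tendsto (fun n => 2 * σ / T * (√(sqNormFunctional n (proj n (k n) (F n))) *
      (√(n : ℝ))⁻¹) + σ ^ 2 / T * ((k n : ℝ) / √(n : ℝ) * (√(n : ℝ))⁻¹)) atTop (𝓝 0) := by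
    have := ((hF.sqrt.mul hinv).const_mul (2 * σ / T)).add ((hk.mul hinv).const_mul (σ ^ 2 / T))
    simpa using this
  have h3 := h1.add h2
  rw [add_zero] at h3
  refine squeeze_zero' (Eventually.of_forall fun n => integral_nonneg fun _ => abs_nonneg _) ?_ h3
  filter_upwards [eventually_ge_atTop 1] with n hn
  have hn0 : (0 : ℝ) < n := by exact_mod_cast hn
  refine (integral_abs_sqNormFunctional_proj_le (by omega) hσ hT (F n)).2.trans (le_of_eq ?_)
  have hN : 0 < √(n : ℝ) := Real.sqrt_pos.2 hn0
  have hNn : (n : ℝ) = √(n : ℝ) ^ 2 := (Real.sq_sqrt hn0.le).symm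
  have hG : √(sqNormFunctional n (proj n (k n) (F n))) = ‖proj n (k n) (F n)‖ / √(n : ℝ) := by
    rw [sqNormFunctional, Real.sqrt_div (sq_nonneg _), Real.sqrt_sq (norm_nonneg _)]
  rw [hG]
  congr 1
  generalize √(n : ℝ) = N at *
  rw [hNn]
  field_simp

theorem tendsto_couplingBound {σ T : ℝ} {k : ℕ → ℕ} {c e : ℕ → ℝ}
    (hk : Tendsto (fun n => (k n : ℝ) / √(n : ℝ)) atTop (𝓝 0))
    (hc : Tendsto (fun n : ℕ => (1 - c n ^ 2) * √(n : ℝ)) atTop (𝓝 0))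
    (he : Tendsto e atTop (𝓝 0)) :
    Tendsto (fun n => couplingBound n (k n) σ T (c n) (e n)) atTop (𝓝 0) := by
  have hinv : Tendsto (fun n : ℕ => (√(n : ℝ))⁻¹) atTop (𝓝 0) :=
    tendsto_inv_atTop_zero.comp tendsto_sqrt_natCast
  have hc' : Tendsto (fun n : ℕ => 1 - c n ^ 2) atTop (𝓝 0) := by
    have := hc.mul hinv
    rw [mul_zero] at this
    refine this.congr' ?_
    filter_upwards [eventually_ge_atTop 1] with n hn
    have hn0 : (0 : ℝ) < n := by exact_mod_cast hn
    have hN : √(n : ℝ) ≠ 0 := (Real.sqrt_pos.2 hn0).ne'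
    field_simp
  have h := (((hc.mul_const (√T / (2 * σ))).add (hc'.mul_const 2)).add
    (((hc.mul_const (√T / (2 * σ))).add hc').mul he)).add (he.add (hk.const_mul (σ / (2 * √T))))
  simp only [zero_mul, mul_zero, add_zero] at h
  refine h.congr fun n => ?_
  unfold couplingBound
  ring

/-- `1 - c² ≤ 2 (1 - c) ≤ 2σ² / (γ n)`, and multiplying by `√n` leaves `2σ² / (γ √n)`. The condition
`1/√n = o(γ)` on the prior is exactly what makes this vanish. -/
theorem tendsto_shrinkage {σ : ℝ} {γ : ℕ → ℝ} (hγ : ∀ n, 1 ≤ n → 0 < γ n)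
    (hγn : (fun n : ℕ => 1 / √(n : ℝ)) =o[atTop] γ) :
    Tendsto (fun n : ℕ => (1 - (γ n * n / (γ n * n + σ ^ 2)) ^ 2) * √(n : ℝ)) atTop (𝓝 0) := by
  have h := hγn.tendsto_div_nhds_zero.const_mul (2 * σ ^ 2)
  rw [mul_zero] at h
  refine squeeze_zero' ?_ ?_ h
  · filter_upwards [eventually_ge_atTop 1] with n hn
    have hn0 : (0 : ℝ) < n := by exact_mod_cast hn
    have hg := hγ n hn
    have hc0 : 0 ≤ γ n * n / (γ n * n + σ ^ 2) := by positivity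
    have hc1 : γ n * n / (γ n * n + σ ^ 2) ≤ 1 := by
      rw [div_le_one (by positivity)]
      nlinarith [sq_nonneg σ]
    exact mul_nonneg (by nlinarith) (Real.sqrt_nonneg _)
  · filter_upwards [eventually_ge_atTop 1] with n hn
    have hn0 : (0 : ℝ) < n := by exact_mod_cast hn
    have hg := hγ n hn
    have hN : 0 < √(n : ℝ) := Real.sqrt_pos.2 hn0
    have hNn : (n : ℝ) = √(n : ℝ) ^ 2 := (Real.sq_sqrt hn0.le).symm
    set c := γ n * n / (γ n * n + σ ^ 2) with hc
    have hpos : 0 < γ n * n := by positivity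
    have h1 : 1 - c = σ ^ 2 / (γ n * n + σ ^ 2) := by
      rw [hc]
      field_simp
      ring
    have h2 : 1 - c ≤ σ ^ 2 / (γ n * n) := by
      rw [h1]
      exact div_le_div_of_nonneg_left (sq_nonneg σ) hpos (by nlinarith [sq_nonneg σ])
    have h3 : 1 - c ^ 2 ≤ 2 * (σ ^ 2 / (γ n * n)) := by nlinarith [sq_nonneg (1 - c)]
    refine (mul_le_mul_of_nonneg_right h3 hN.le).trans (le_of_eq ?_)
    generalize √(n : ℝ) = N at *
    rw [hNn]
    field_simp

end FourierRegression

/-! ### The main theorem -/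

theorem proposition6 (α L σ : ℝ) (hα : 1 / 2 < α) (hL : 0 < L) (hσ : 0 < σ)
    (f : ℝ → ℝ) (hf : f ∈ sobolevClass α L) (hfc : ContinuousOn f (Set.Icc 0 1))
    (hf0 : 0 < ∫ x in (0 : ℝ)..1, f x ^ 2)
    (γ : ℕ → ℝ) (hγ : ∀ n, 1 ≤ n → 0 < γ n)
    (hγn : (fun n : ℕ => 1 / √(n : ℝ)) =o[atTop] γ) :
    -- suitable cutoffs exist
    (∃ k : ℕ → ℕ, (∀ n, 1 ≤ n → 1 ≤ k n ∧ k n ≤ n) ∧ AdmissibleCutoff α k) ∧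
    -- adaptivity: one and the same cutoff is suitable for every regularity
    (∀ β : ℝ, 1 / 2 < β →
      AdmissibleCutoff β (fun n : ℕ => ⌊√(n : ℝ) / Real.log (n : ℝ)⌋₊)) ∧
    ∀ k : ℕ → ℕ, AdmissibleCutoff α k →
      -- asymptotic normality of the posterior
      Tendsto
        (fun n : ℕ => ∫⁻ y,
          intervalDist
            ((posteriorDist n (k n) σ (γ n) y).map fun F =>
              √(n : ℝ) * (sqNormFunctional n F - sqNormFunctional n (proj n (k n) y)) /
                (2 * σ * √(∫ x in (0 : ℝ)..1, f x ^ 2)))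
            (gaussianReal 0 1)
          ∂(sampling n σ (designValues n f)))
        atTop (𝓝 0) ∧
      -- asymptotic normality of the plug-in estimator
      TendstoInDistribution
        (fun (n : ℕ) (y : EuclideanSpace ℝ (Fin n)) =>
          √(n : ℝ) * (sqNormFunctional n (proj n (k n) y) -
              sqNormFunctional n (proj n (k n) (designValues n f))) /
            (2 * σ * √(∫ x in (0 : ℝ)..1, f x ^ 2)))
        atTop (id : ℝ → ℝ)
        (fun n : ℕ => sampling n σ (designValues n f)) (gaussianReal 0 1) ∧
      -- the bias is negligible
      (fun n : ℕ =>
          √(n : ℝ) * (sqNormFunctional n (proj n (k n) (designValues n f)) -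
              ∫ x in (0 : ℝ)..1, f x ^ 2) /
            (2 * σ * √(∫ x in (0 : ℝ)..1, f x ^ 2)))
        =o[atTop] (fun _ : ℕ => (1 : ℝ)) := by
  refine ⟨exists_admissibleCutoff hα, fun β hβ => admissibleCutoff_floor hβ, fun k hk => ?_⟩
  have hbias := tendsto_bias hα hf hfc hk
  have hG := tendsto_sqNormFunctional hα hf hfc hk
  have hbd := hk.eventually_bounds (by linarith)
  set T := ∫ x in (0 : ℝ)..1, f x ^ 2 with hT
  refine ⟨?_, ?_, ?_⟩
  · have he := tendsto_integral_abs_ratio_sub_one (F := fun n => designValues n f) hσ hf0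
      hk.tendsto_div_sqrt hG
    have hB := tendsto_couplingBound (σ := σ) (T := T) hk.tendsto_div_sqrt
      (tendsto_shrinkage (σ := σ) hγ hγn) he
    rw [ENNReal.tendsto_nhds_zero]
    intro ε hε
    obtain ⟨r, hr0, hr⟩ := ENNReal.lt_iff_exists_nnreal_btwn.1 hε
    -- With `δ = r / 3` and coupling bound at most `δ²`, the estimate `b / δ + 2δ` is at most `3δ =
    -- r`.
    have hδ : (0 : ℝ) < r / 3 := by
      have : (0 : ℝ) < r := by exact_mod_cast hr0
      positivity
    filter_upwards [hbd, hB.eventually_le_const (by positivity : 0 < (r / 3 : ℝ) ^ 2),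
      eventually_ge_atTop 1] with n hkn hBn hn
    refine (lintegral_intervalDist_posterior_le hkn.2 hσ hf0 (hγ n hn) _ hδ).trans
      (le_trans ?_ hr.le)
    rw [← ENNReal.ofReal_coe_nnreal]
    refine ENNReal.ofReal_le_ofReal ?_
    have h1 := div_le_div_of_nonneg_right hBn hδ.le
    have h2 : (r / 3 : ℝ) ^ 2 / (r / 3) = r / 3 := by field_simp
    rw [h2] at h1
    linarith
  · have he : Tendsto (fun n => |sqNormFunctional n (proj n (k n) (designValues n f)) / T - 1|)
        atTop (𝓝 0) := by
      have := ((hG.div_const T).sub_const 1).abs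
      simpa [hf0.ne'] using this
    have hB := tendsto_couplingBound (σ := σ) (T := T) (c := fun _ => 1) hk.tendsto_div_sqrt
      (by simp) he
    refine tendstoInDistribution_of_coupling (fun n => ?_) hB ?_
    · have h1 := measurable_proj n (k n)
      have h2 := measurable_sqNormFunctional n
      fun_prop
    · filter_upwards [eventually_ge_atTop 1] with n hn
      exact exists_coupling_plugin (by omega) (k n) hσ hf0 _
  · rw [isLittleO_one_iff]
    simpa using hbias.div_const (2 * σ * √T)
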